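/- Corollary 1.14. Conventions. Let $(X_0,X_1)$ be a compatible couple, i.e. $X_0,X_1$ are Banach spaces continuously embedded in a Hausdorff topological vector space; $X_0\cap X_1$ and $X_0+X_1$ carry the norms $\max\{\|f\|_{X_0},\|f\|_{X_1}\}$ and $\inf\{\|f_0\|_{X_0}+\|f_1\|_{X_1}: f=f_0+f_1,\ f_i\in X_i\}$. For $t>0$ put $$K(f,t)=\inf\{\|f_0\|_{X_0}+t\|f_1\|_{X_1}: f=f_0+f_1,\ f_0\in X_0,\ f_1\in X_1\}\quad(f\in X_0+X_1),$$ $$J(f,t)=\max\{\|f\|_{X_0},\,t\|f\|_{X_1}\}\quad(f\in X_0\cap X_1).$$ For $1\le q\le\infty$ and a weight $v$ on $(0,\infty)$, $(X_0,X_1)_{0,q,v;K}$ is the set of all $f\in X_0+X_1$ with $$\|f\|_{0,q,v;K}:=\big\|t^{-1/q}v(t)K(f,t)\big\|_{L_q(0,\infty)}<\infty ,$$ and $(X_0,X_1)_{0,q,v;J}$ is the set of all $f\in X_0+X_1$ with $$\|f\|_{0,q,v;J}:=\inf_u\big\|t^{-1/q}v(t)J(u(t),t)\big\|_{L_q(0,\infty)}<\infty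 ,$$ the infimum being taken over all strongly measurable $u:(0,\infty)\to X_0\cap X_1$ such that $f=\int_0^\infty u(s)\,\frac{ds}{s}$ as a convergent Bochner integral in $X_0+X_1$ (so the infimum is $\infty$ if there is no such $u$). For positive functions, $f\approx g$ on a set means that $c\,g\le f\le C\,g$ there with constants $c,C>0$. A positive, finite, Lebesgue measurable function $b$ on $(0,\infty)$ is slowly varying, $b\in SV(0,\infty)$, if for each $\varepsilon>0$ there are a non-decreasing $\varphi$ and a non-increasing $\psi$ with $t^{\varepsilon}b(t)\approx\varphi(t)$ and $t^{-\varepsilon}b(t)\approx\psi(t)$ on $(0,\infty)$. Statement. Let $1<q\le\infty$ and $1/q+1/q'=1$. Let $a\in SV(0,\infty)$ satisfy $$\int_0^\infty t^{-1}a^{-q'}(t)\,dt<\infty ,$$ let $\alpha\in SV(0,\infty)$ satisfy $$\int_0^x t^{-1}\alpha^{-q'}(t)\,dt<\infty\ \text{ for all } x>0,\qquad \int_0^\infty t^{-1}\alpha^{-q'}(t)\,dt=\infty ,$$ let $A\in SV(0,\infty)$ satisfy $A(x)=a(x)$ for $x\in(0,1]$ and $A(x)\approx\alpha(x)$ on $(1,\infty)$,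 and let $$B(x)=A^{-q'/q}(x)\Big(\int_0^x t^{-1}A^{-q'}(t)\,dt\Big)^{-1}\quad\text{for all }x>0$$ (with $q'/q=0$ if $q=\infty$). Then $$(X_0,X_1)_{0,q,a;J}=X_0\cap (X_0,X_1)_{0,q,A;J}=X_0\cap (X_0,X_1)_{0,q,B;K},$$ as subsets of $X_0+X_1$ and with equivalent norms, where for a space $Y\subseteq X_0+X_1$ the intersection $X_0\cap Y$ carries the norm $\max\{\|f\|_{X_0},\|f\|_Y\}$. -/

import Mathlib

open Set MeasureTheory
open scoped ENNReal NNReal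

/-- Two real functions are equivalent on `s` (used for positive functions): each is bounded
by a positive constant multiple of the other. -/
def EquivOn (s : Set ℝ) (f g : ℝ → ℝ) : Prop :=
  ∃ c C : ℝ, 0 < c ∧ 0 < C ∧ ∀ t ∈ s, c * g t ≤ f t ∧ f t ≤ C * g t

/-- The class `SV(0,∞)` of slowly varying functions. Only the values on `(0,∞)` matter;
`AEMeasurable` with respect to Lebesgue measure on `(0,∞)` is Lebesgue measurability. -/
structure SlowlyVarying (b : ℝ → ℝ) : Prop where
  pos : ∀ t ∈ Ioi (0 : ℝ), 0 < b t
  measurable : AEMeasurable b (volume.restrict (Ioi 0))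
  equiv_nondecreasing : ∀ ε : ℝ, 0 < ε →
    ∃ φ : ℝ → ℝ, MonotoneOn φ (Ioi 0) ∧ EquivOn (Ioi 0) (fun t => t ^ ε * b t) φ
  equiv_nonincreasing : ∀ ε : ℝ, 0 < ε →
    ∃ φ : ℝ → ℝ, AntitoneOn φ (Ioi 0) ∧ EquivOn (Ioi 0) (fun t => t ^ (-ε) * b t) φ

/-- A pair of normed spaces continuously embedded in one topological vector space `E`
(in the theorem: Banach spaces and a Hausdorff space `E`). -/
structure CompatibleCouple (X₀ X₁ E : Type*)
    [NormedAddCommGroup X₀] [NormedSpace ℝ X₀] [NormedAddCommGroup X₁] [NormedSpace ℝ X₁]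
    [AddCommGroup E] [Module ℝ E] [TopologicalSpace E] where
  ι₀ : X₀ →L[ℝ] E
  ι₁ : X₁ →L[ℝ] E
  injective₀ : Function.Injective ι₀
  injective₁ : Function.Injective ι₁

namespace CompatibleCouple

noncomputable section

variable {X₀ X₁ E : Type*}
  [NormedAddCommGroup X₀] [NormedSpace ℝ X₀] [NormedAddCommGroup X₁] [NormedSpace ℝ X₁]
  [AddCommGroup E] [Module ℝ E] [TopologicalSpace E] [IsTopologicalAddGroup E]
  (C : CompatibleCouple X₀ X₁ E)

/-- The map `(x₀, x₁) ↦ x₀ + x₁` into the ambient space, on the product with norm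
`‖x₀‖ + ‖x₁‖`. -/
def addMap : WithLp 1 (X₀ × X₁) →L[ℝ] E :=
  C.ι₀ ∘L WithLp.fstL 1 ℝ X₀ X₁ + C.ι₁ ∘L WithLp.sndL 1 ℝ X₀ X₁

/-- The pairs `(x₀, x₁)` with `x₀ + x₁ = 0` in the ambient space. -/
def addKer : Submodule ℝ (WithLp 1 (X₀ × X₁)) := LinearMap.ker C.addMap.toLinearMap

instance isClosed_addKer [T2Space E] : IsClosed (C.addKer : Set (WithLp 1 (X₀ × X₁))) :=
  C.addMap.isClosed_ker

/-- The Banach space `X₀ + X₁`: pairs `(x₀, x₁)` up to equality of `x₀ + x₁` in the ambient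
space, with the quotient norm, which is `inf {‖x₀‖ + ‖x₁‖ : f = x₀ + x₁}`. -/
abbrev SumSpace : Type _ := WithLp 1 (X₀ × X₁) ⧸ C.addKer

/-- The element `x₀ + x₁` of `X₀ + X₁`. -/
def mkSum (x₀ : X₀) (x₁ : X₁) : C.SumSpace := C.addKer.mkQ (WithLp.toLp 1 (x₀, x₁))

/-- The Banach space `X₀ ∩ X₁`: pairs `(x₀, x₁)` with `x₀ = x₁` in the ambient space, with norm
`max ‖x₀‖ ‖x₁‖`. -/
abbrev InterSpace : Type _ :=
  (LinearMap.eqLocus (C.ι₀ ∘L ContinuousLinearMap.fst ℝ X₀ X₁).toLinearMap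
    (C.ι₁ ∘L ContinuousLinearMap.snd ℝ X₀ X₁).toLinearMap : Submodule ℝ (X₀ × X₁))

/-- The inclusion of `X₀ ∩ X₁` in `X₀ + X₁`. -/
def interToSum (u : C.InterSpace) : C.SumSpace := C.mkSum u.1.1 0

/-- Peetre's `K`-functional `K(f,t;X₀,X₁)`, for `t > 0`. -/
def K (f : C.SumSpace) (t : ℝ) : ℝ :=
  sInf {r : ℝ | ∃ (f₀ : X₀) (f₁ : X₁), f = C.mkSum f₀ f₁ ∧ r = ‖f₀‖ + t * ‖f₁‖}

/-- Peetre's `J`-functional `J(f,t;X₀,X₁)`, for `t > 0`. -/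
def J (f : C.InterSpace) (t : ℝ) : ℝ := max ‖f.1.1‖ (t * ‖f.1.2‖)

/-- The norm of `(X₀,X₁)_{θ,q,v;K}`, with value `∞` outside the space. -/
def kNorm (θ : ℝ) (q : ℝ≥0∞) (v : ℝ → ℝ) (f : C.SumSpace) : ℝ≥0∞ :=
  eLpNorm (fun t : ℝ => t ^ (-θ - q⁻¹.toReal) * v t * C.K f t) q (volume.restrict (Ioi 0))

/-- `u` represents `f`, that is, `f = ∫_0^∞ u(s) ds/s` with `u : (0,∞) → X₀ ∩ X₁` strongly
measurable, and the integral is a convergent Bochner integral in `X₀ + X₁`. -/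
structure Represents [T2Space E] (u : ℝ → C.InterSpace) (f : C.SumSpace) : Prop where
  stronglyMeasurable : AEStronglyMeasurable u (volume.restrict (Ioi 0))
  integrable : IntegrableOn (fun s : ℝ => s⁻¹ • C.interToSum (u s)) (Ioi 0)
  integral_eq : ∫ s in Ioi (0 : ℝ), s⁻¹ • C.interToSum (u s) = f

/-- The norm of `(X₀,X₁)_{θ,q,v;J}`, with value `∞` outside the space (in particular, for `f`
without a representation the infimum is over the empty set). -/
def jNorm [T2Space E] (θ : ℝ) (q : ℝ≥0∞) (v : ℝ → ℝ) (f : C.SumSpace) : ℝ≥0∞ :=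
  ⨅ (u : ℝ → C.InterSpace) (_ : C.Represents u f),
    eLpNorm (fun t : ℝ => t ^ (-θ - q⁻¹.toReal) * v t * C.J (u t) t) q (volume.restrict (Ioi 0))

/-- The norm of `X₀` as a subspace of `X₀ + X₁`, with value `∞` outside `X₀`. The infimum is over
at most one `x`, as `X₀` is embedded in the ambient space. -/
def norm₀ (f : C.SumSpace) : ℝ≥0∞ := ⨅ (x : X₀) (_ : C.mkSum x 0 = f), ‖x‖ₑ

/-- The norm of `X₀ ∩ Y`, where `Y ⊆ X₀ + X₁` has the norm `N` (with value `∞` outside `Y`). -/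
def interNorm₀ (N : C.SumSpace → ℝ≥0∞) (f : C.SumSpace) : ℝ≥0∞ := max (C.norm₀ f) (N f)

end

end CompatibleCouple

/-- The spaces `{f | N f < ∞}` and `{f | M f < ∞}` with norms `N` and `M` coincide: they are the
same subset of `V`, and their norms are equivalent. -/
def Coincide {V : Type*} (N M : V → ℝ≥0∞) : Prop :=
  {f | N f < ∞} = {f | M f < ∞} ∧
    ∃ c : ℝ≥0, ∀ f, N f < ∞ → N f ≤ c * M f ∧ M f ≤ c * N f

/-! Put `μ = t⁻¹ v(t)^{-q'} dt` and `W(x) = μ((0,x])`. Because `q(1 - q') = -q'`, the `J`-norm with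
weight `v` minimizes the `L_q(μ)` norm of `v^{q'} J(u(t),t)`. For `v = A`, the weight `B` is chosen
so that the `K`-norm is exactly the `L_q(μ)` norm of `W⁻¹ K(f,·)`. The question thus becomes one
about averages with respect to `μ`.

First equality. Since `∫ t⁻¹ a^{-q'} < ∞`, Hölder's inequality makes every representation of finite
norm converge in `X₀`; this embeds the `J`-space of `a` in `X₀` (`exists_norm₀_le_jNorm`). If `f` is
in `X₀`, a representation can be cut at `1`. The piece over `(1,∞)` converges in `X₁`, and it equals
`f` minus the `X₀`-valued integral over `(0,1]`, so it lies in `X₀ ∩ X₁`. A single element `w` of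
the intersection is represented on `(1,2]` at a cost proportional to `‖w‖`. On `X₀`, therefore, only
the weight on `(0,1]` matters (`exists_jNorm_le_interNorm₀`), and there `a = A`.

Second equality, `K` bounded by `J` (`exists_kNorm_le_jNorm`). Splitting a representation at `t`
bounds `W(t)⁻¹ K(f,t)` by a `μ`-average over `(0,t]` plus a tail with kernel `t/s`. Both operators
are bounded on `L_q(μ)` by Schur's test.

Second equality, `J` bounded by `K` (`exists_represents_of_K`). Take points `s_n` with `W(s_n) =
W(1)/2ⁿ` and nearly optimal decompositions of `f` at these levels. Differences of consecutive ones
lie in `X₀ ∩ X₁` and have `J` controlled by `K`; each is spread over a short interval with density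
proportional to `v^{-q'}`. The sum telescopes to the `X₀`-part at level `s_1`, because `K(f,s_n) →
0`. For `f` in `X₀` the remaining part lies in `X₀ ∩ X₁` and is absorbed as before. -/

/-! ### Slowly varying functions and the weight measure -/

namespace SlowlyVarying

/-- Potter-type bounds with exponent `1/2`. -/
theorem exists_bound {b : ℝ → ℝ} (hb : SlowlyVarying b) :
    ∃ c : ℝ, 0 < c ∧ ∀ s t : ℝ, 0 < s → s ≤ t →
      b s ≤ c * (t / s) ^ (1 / 2 : ℝ) * b t ∧ b t ≤ c * (t / s) ^ (1 / 2 : ℝ) * b s := by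
  -- The value `1/2` is a convenient choice: an exponent below `1` makes the integrals in the tail
  -- form of Hardy's inequality converge.
  obtain ⟨φ, hφ, c₁, C₁, hc₁, hC₁, h₁⟩ := hb.equiv_nondecreasing (1 / 2) (by norm_num)
  obtain ⟨ψ, hψ, c₂, C₂, hc₂, hC₂, h₂⟩ := hb.equiv_nonincreasing (1 / 2) (by norm_num)
  refine ⟨C₁ / c₁ + C₂ / c₂, by positivity, fun s t hs hst => ?_⟩
  have ht : 0 < t := hs.trans_le hst
  have hbs := hb.pos s hs
  have hbt := hb.pos t ht
  have hsp : 0 < s ^ (1 / 2 : ℝ) := Real.rpow_pos_of_pos hs _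
  have htp : 0 < t ^ (1 / 2 : ℝ) := Real.rpow_pos_of_pos ht _
  rw [Real.div_rpow ht.le hs.le]
  have hr : 0 < t ^ (1 / 2 : ℝ) / s ^ (1 / 2 : ℝ) := div_pos htp hsp
  constructor
  · have h1 := (h₁ s hs).2
    have h2 := (h₁ t ht).1
    have h3 := hφ (mem_Ioi.2 hs) (mem_Ioi.2 ht) hst
    have h4 : s ^ (1 / 2 : ℝ) * b s ≤ C₁ / c₁ * (t ^ (1 / 2 : ℝ) * b t) := by
      calc s ^ (1 / 2 : ℝ) * b s ≤ C₁ * φ t := h1.trans (by gcongr)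
        _ = C₁ / c₁ * (c₁ * φ t) := by field_simp
        _ ≤ _ := by gcongr
    calc b s = (s ^ (1 / 2 : ℝ) * b s) / s ^ (1 / 2 : ℝ) := by field_simp
      _ ≤ C₁ / c₁ * (t ^ (1 / 2 : ℝ) * b t) / s ^ (1 / 2 : ℝ) := by gcongr
      _ = C₁ / c₁ * (t ^ (1 / 2 : ℝ) / s ^ (1 / 2 : ℝ)) * b t := by ring
      _ ≤ _ := by
        gcongr
        exact le_add_of_nonneg_right (by positivity)
  · have h1 := (h₂ t ht).2
    have h2 := (h₂ s hs).1
    have h3 := hψ (mem_Ioi.2 hs) (mem_Ioi.2 ht) hst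
    simp only [Real.rpow_neg hs.le, Real.rpow_neg ht.le] at h1 h2
    have h4 : (t ^ (1 / 2 : ℝ))⁻¹ * b t ≤ C₂ / c₂ * ((s ^ (1 / 2 : ℝ))⁻¹ * b s) := by
      calc (t ^ (1 / 2 : ℝ))⁻¹ * b t ≤ C₂ * ψ s := h1.trans (by gcongr)
        _ = C₂ / c₂ * (c₂ * ψ s) := by field_simp
        _ ≤ _ := by gcongr
    calc b t = t ^ (1 / 2 : ℝ) * ((t ^ (1 / 2 : ℝ))⁻¹ * b t) := by field_simp
      _ ≤ t ^ (1 / 2 : ℝ) * (C₂ / c₂ * ((s ^ (1 / 2 : ℝ))⁻¹ * b s)) := by gcongr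
      _ = C₂ / c₂ * (t ^ (1 / 2 : ℝ) / s ^ (1 / 2 : ℝ)) * b s := by ring
      _ ≤ _ := by
        gcongr
        exact le_add_of_nonneg_left (by positivity)

end SlowlyVarying

/-- The measure `t⁻¹ v(t)⁻ʳ dt` on `(0,∞)`. -/
noncomputable def weightMeasure (r : ℝ) (v : ℝ → ℝ) : Measure ℝ :=
  (volume.restrict (Ioi 0)).withDensity fun t => ENNReal.ofReal (t⁻¹ * v t ^ (-r))

section weightMeasure

variable {r : ℝ} {v : ℝ → ℝ}

theorem aemeasurable_inv_mul_rpow (hv : AEMeasurable v (volume.restrict (Ioi 0))) :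
    AEMeasurable (fun t => ENNReal.ofReal (t⁻¹ * v t ^ (-r))) (volume.restrict (Ioi 0)) :=
  (measurable_inv.aemeasurable.mul (hv.pow_const _)).ennreal_ofReal

theorem weightMeasure_absolutelyContinuous : weightMeasure r v ≪ volume.restrict (Ioi 0) :=
  withDensity_absolutelyContinuous _ _

/-- The density is positive, so no null sets are gained. This matters for `q = ∞`, where the norm
sees the measure only through its null sets. -/
theorem absolutelyContinuous_weightMeasure (hv0 : ∀ t ∈ Ioi (0 : ℝ), 0 < v t)
    (hv : AEMeasurable v (volume.restrict (Ioi 0))) :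
    volume.restrict (Ioi 0) ≪ weightMeasure r v := by
  refine withDensity_absolutelyContinuous' (aemeasurable_inv_mul_rpow hv) ?_
  filter_upwards [ae_restrict_mem measurableSet_Ioi] with t ht
  have := hv0 t ht
  have ht' : 0 < t := ht
  simp only [ne_eq, ENNReal.ofReal_eq_zero, not_le]
  positivity

theorem ae_weightMeasure_mem : ∀ᵐ t ∂weightMeasure r v, t ∈ Ioi (0 : ℝ) :=
  weightMeasure_absolutelyContinuous (ae_restrict_mem measurableSet_Ioi)

theorem ae_weightMeasure_of_forall {p : ℝ → Prop} (h : ∀ t, 0 < t → p t) :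
    ∀ᵐ t ∂weightMeasure r v, p t := by
  filter_upwards [ae_weightMeasure_mem] with t ht using h t ht

instance : SFinite (weightMeasure r v) := by unfold weightMeasure; infer_instance

instance : NullSingletonClass (weightMeasure r v) := by unfold weightMeasure; infer_instance

theorem setLIntegral_weightMeasure (hv : AEMeasurable v (volume.restrict (Ioi 0)))
    {S : Set ℝ} (hS : MeasurableSet S) (hS0 : S ⊆ Ioi 0) (g : ℝ → ℝ≥0∞) :
    ∫⁻ t in S, g t ∂weightMeasure r v = ∫⁻ t in S, ENNReal.ofReal (t⁻¹ * v t ^ (-r)) * g t := by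
  rw [weightMeasure, restrict_withDensity hS, Measure.restrict_restrict hS,
    inter_eq_self_of_subset_left hS0, lintegral_withDensity_eq_lintegral_mul_non_measurable₀]
  · rfl
  · exact (aemeasurable_inv_mul_rpow hv).mono_measure (Measure.restrict_mono hS0 le_rfl)
  · simp

theorem lintegral_weightMeasure (hv : AEMeasurable v (volume.restrict (Ioi 0))) (g : ℝ → ℝ≥0∞) :
    ∫⁻ t, g t ∂weightMeasure r v =
      ∫⁻ t in Ioi 0, ENNReal.ofReal (t⁻¹ * v t ^ (-r)) * g t := by
  rw [weightMeasure, lintegral_withDensity_eq_lintegral_mul_non_measurable₀]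
  · rfl
  · exact aemeasurable_inv_mul_rpow hv
  · simp

theorem weightMeasure_apply (hv : AEMeasurable v (volume.restrict (Ioi 0)))
    {S : Set ℝ} (hS : MeasurableSet S) (hS0 : S ⊆ Ioi 0) :
    weightMeasure r v S = ∫⁻ t in S, ENNReal.ofReal (t⁻¹ * v t ^ (-r)) := by
  simpa using setLIntegral_weightMeasure (r := r) hv hS hS0 1

/-- The factor `v^r` undoes the density, which moves integrals `∫ g dt/t` to the side where Hölder
and Hardy are applied. -/
theorem setLIntegral_inv_mul (hv0 : ∀ t ∈ Ioi (0 : ℝ), 0 < v t)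
    (hv : AEMeasurable v (volume.restrict (Ioi 0)))
    {S : Set ℝ} (hS : MeasurableSet S) (hS0 : S ⊆ Ioi 0) (g : ℝ → ℝ) :
    ∫⁻ t in S, ENNReal.ofReal (t⁻¹ * g t) =
      ∫⁻ t in S, ENNReal.ofReal (v t ^ r * g t) ∂weightMeasure r v := by
  rw [setLIntegral_weightMeasure hv hS hS0]
  refine setLIntegral_congr_fun hS fun t ht => ?_
  have h0 : 0 < t := hS0 ht
  have h1 := hv0 t (hS0 ht)
  rw [← ENNReal.ofReal_mul (by positivity), Real.rpow_neg h1.le]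
  have := Real.rpow_pos_of_pos h1 r
  congr 1
  field_simp

end weightMeasure

/-! ### Conjugate exponents, weighted norms and Hölder's inequality -/

section exponents

variable {q q' : ℝ≥0∞}

theorem conj_ne_top (hq : 1 < q) (hqq' : q⁻¹ + q'⁻¹ = 1) : q' ≠ ∞ := by
  rintro rfl
  simp at hqq'
  exact hq.ne' hqq'

theorem one_le_conj_toReal (hq : 1 < q) (hqq' : q⁻¹ + q'⁻¹ = 1) : 1 ≤ q'.toReal := by
  have h1 : 1 ≤ q' := by
    rw [← ENNReal.inv_le_one, ← hqq']
    exact le_add_self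
  simpa using ENNReal.toReal_mono (conj_ne_top hq hqq') h1

theorem conj_inv_toReal (hqq' : q⁻¹ + q'⁻¹ = 1) :
    q.toReal⁻¹ + q'.toReal⁻¹ = 1 := by
  have h := congrArg ENNReal.toReal hqq'
  have h1 : q'⁻¹ ≠ ∞ := fun h => by simp [h] at hqq'
  have h2 : q⁻¹ ≠ ∞ := fun h => by simp [h] at hqq'
  rw [ENNReal.toReal_add h2 h1] at h
  simpa using h

theorem conj_div_toReal (hq : 1 < q) (hqq' : q⁻¹ + q'⁻¹ = 1) :
    (q' / q).toReal = q'.toReal - 1 := by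
  have h := conj_inv_toReal hqq'
  have h1 := one_le_conj_toReal hq hqq'
  rw [ENNReal.toReal_div, div_eq_mul_inv, eq_sub_of_add_eq h]
  field_simp

theorem one_lt_toReal (hq : 1 < q) (hqt : q ≠ ∞) : 1 < q.toReal := by
  simpa using (ENNReal.toReal_lt_toReal (by simp) hqt).2 hq

theorem holderConjugate_toReal (hq : 1 < q) (hqq' : q⁻¹ + q'⁻¹ = 1) (hqt : q ≠ ∞) :
    q.toReal.HolderConjugate q'.toReal :=
  Real.holderConjugate_iff.2 ⟨one_lt_toReal hq hqt, conj_inv_toReal hqq'⟩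

/-- The weighted `L_q` norms of the limiting interpolation spaces are `L_q` norms with respect to
`weightMeasure`. -/
theorem eLpNorm_weight {v : ℝ → ℝ} (hq : 1 < q) (hqq' : q⁻¹ + q'⁻¹ = 1)
    (hv0 : ∀ t ∈ Ioi (0 : ℝ), 0 < v t) (hv : AEMeasurable v (volume.restrict (Ioi 0)))
    (h : ℝ → ℝ) :
    eLpNorm (fun t => t ^ (-0 - q⁻¹.toReal) * v t ^ (1 - q'.toReal) * h t) q
      (volume.restrict (Ioi 0)) = eLpNorm h q (weightMeasure q'.toReal v) := by
  by_cases hqt : q = ∞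
  · subst hqt
    have : q'.toReal = 1 := by
      have := conj_inv_toReal hqq'
      simpa using this
    simp only [this, ENNReal.inv_top, ENNReal.toReal_zero, neg_zero, sub_self, Real.rpow_zero,
      one_mul, eLpNorm_exponent_top]
    -- Here `q' = 1`, the weight is trivial, and essential suprema agree because the two measures
    -- have the same null sets.
    apply le_antisymm
    · exact eLpNormEssSup_mono_measure _ (absolutelyContinuous_weightMeasure hv0 hv)
    · exact eLpNormEssSup_mono_measure _ weightMeasure_absolutelyContinuous
  · have hc := holderConjugate_toReal hq hqq' hqt
    have h1 := hc.pos
    rw [eLpNorm_eq_lintegral_rpow_enorm_toReal (by positivity) hqt,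
      eLpNorm_eq_lintegral_rpow_enorm_toReal (by positivity) hqt, lintegral_weightMeasure hv]
    congr 1
    refine setLIntegral_congr_fun measurableSet_Ioi fun t ht => ?_
    have ht0 : 0 < t := ht
    have hvt := hv0 t ht
    rw [enorm_mul, ENNReal.mul_rpow_of_nonneg _ _ h1.le]
    congr 1
    rw [Real.enorm_of_nonneg (by positivity), ENNReal.ofReal_rpow_of_nonneg (by positivity) h1.le,
      Real.mul_rpow (by positivity) (by positivity), ← Real.rpow_mul ht0.le, ← Real.rpow_mul hvt.le]
    congr 2
    · rw [← Real.rpow_neg_one]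
      congr 1
      simp only [neg_zero, zero_sub, ENNReal.toReal_inv]
      field_simp
    -- The exponent of `v`: `q(1 - q') = -q'`, from `qq' = q + q'`.
    · congr 1
      have := hc.mul_eq_add
      linarith

end exponents

section Hoelder

variable {q q' : ℝ≥0∞} {v : ℝ → ℝ}

theorem setLIntegral_enorm_le {α : Type*} [MeasurableSpace α] {μ : Measure α}
    (hq : 1 < q) (hqq' : q⁻¹ + q'⁻¹ = 1) {h : α → ℝ} {S : Set α}
    (hh : AEStronglyMeasurable h (μ.restrict S)) :
    ∫⁻ t in S, ‖h t‖ₑ ∂μ ≤ eLpNorm h q (μ.restrict S) * μ S ^ (q'.toReal⁻¹) := by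
  have := eLpNorm_le_eLpNorm_mul_rpow_measure_univ hq.le hh
  rw [eLpNorm_one_eq_lintegral_enorm] at this
  refine this.trans_eq ?_
  congr 1
  rw [Measure.restrict_apply_univ]
  congr 1
  have := conj_inv_toReal hqq'
  simp
  linarith

/-- Hölder's inequality for `∫ g dt/t`. -/
theorem setLIntegral_inv_mul_le (hq : 1 < q) (hqq' : q⁻¹ + q'⁻¹ = 1)
    (hv0 : ∀ t ∈ Ioi (0 : ℝ), 0 < v t) (hv : AEMeasurable v (volume.restrict (Ioi 0)))
    {S : Set ℝ} (hS : MeasurableSet S) (hS0 : S ⊆ Ioi 0) {g : ℝ → ℝ}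
    (hg : AEMeasurable g (volume.restrict (Ioi 0))) :
    ∫⁻ t in S, ENNReal.ofReal (t⁻¹ * g t) ≤
      eLpNorm (fun t => t ^ (-0 - q⁻¹.toReal) * v t * g t) q (volume.restrict (Ioi 0)) *
        weightMeasure q'.toReal v S ^ (q'.toReal⁻¹) := by
  set r := q'.toReal with hr
  have hm : AEStronglyMeasurable (fun t => v t ^ r * g t) (weightMeasure r v) :=
    (((hv.pow_const r).mul hg).mono_ac weightMeasure_absolutelyContinuous).aestronglyMeasurable
  rw [setLIntegral_inv_mul (r := r) hv0 hv hS hS0]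
  calc _ ≤ ∫⁻ t in S, ‖v t ^ r * g t‖ₑ ∂weightMeasure r v :=
        lintegral_mono fun t => Real.ofReal_le_enorm _
    _ ≤ _ := setLIntegral_enorm_le hq hqq' hm.restrict
    _ ≤ eLpNorm (fun t => v t ^ r * g t) q (weightMeasure r v) *
        weightMeasure q'.toReal v S ^ (q'.toReal⁻¹) := by
      gcongr
      exact Measure.restrict_le_self
    _ = _ := by
      rw [hr, ← eLpNorm_weight hq hqq' hv0 hv]
      congr 1
      refine eLpNorm_congr_ae ?_
      filter_upwards [ae_restrict_mem measurableSet_Ioi] with t ht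
      have hvt := hv0 t ht
      rw [mul_assoc, mul_assoc, ← mul_assoc (v t ^ _), ← Real.rpow_add hvt]
      simp

end Hoelder

/-! ### Schur's test -/

section Schur

variable {α : Type*} [MeasurableSpace α] {μ : Measure α} [SFinite μ]

/-- Hölder's inequality is applied to `k g = (k P)^{1/q'} (k P^{-(q-1)} g^q)^{1/q}`, where the
powers of `P` cancel since `(q-1)/q = 1/q'`. The first factor is controlled by `h₁`. After
integration in `t` and Tonelli, `h₂` controls the second, and the powers of `P` cancel again. -/
theorem lintegral_rpow_kernel_le {q : ℝ} (hq : 1 < q) {k : α → α → ℝ≥0∞}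
    (hk : Measurable (Function.uncurry k)) {P : α → ℝ≥0∞} (hP : AEMeasurable P μ)
    (hP0 : ∀ᵐ t ∂μ, P t ≠ 0 ∧ P t ≠ ∞) {C : ℝ≥0∞}
    (h₁ : ∀ᵐ t ∂μ, ∫⁻ s, k t s * P s ∂μ ≤ C * P t)
    (h₂ : ∀ᵐ s ∂μ, ∫⁻ t, k t s * P t ^ (q - 1) ∂μ ≤ C * P s ^ (q - 1))
    {g : α → ℝ≥0∞} (hg : AEMeasurable g μ) :
    ∫⁻ t, (∫⁻ s, k t s * g s ∂μ) ^ q ∂μ ≤ C ^ q * ∫⁻ t, g t ^ q ∂μ := by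
  have hc : q.conjExponent.HolderConjugate q := (Real.HolderConjugate.conjExponent hq).symm
  set q' := q.conjExponent with hq'
  have hq0 : 0 < q := hc.symm.pos
  have hq'0 : 0 < q' := hc.pos
  have hqq : q / q' = q - 1 := by
    rw [hq', Real.conjExponent]; field_simp
  have hsum : q'⁻¹ + q⁻¹ = 1 := hc.inv_add_inv_eq_one
  have key : ∀ᵐ t ∂μ, (∫⁻ s, k t s * g s ∂μ) ^ q ≤
      C ^ (q - 1) * (∫⁻ s, P t ^ (q - 1) * k t s * (P s ^ (-(q - 1)) * g s ^ q) ∂μ) := by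
    filter_upwards [h₁, hP0] with t ht hPt
    have hkt : Measurable (k t) := hk.comp measurable_prodMk_left
    have e1 : ∫⁻ s, k t s * g s ∂μ = ∫⁻ s, ((fun s => (k t s * P s) ^ (1 / q')) *
        (fun s => (k t s * (P s ^ (-(q - 1)) * g s ^ q)) ^ (1 / q))) s ∂μ := by
      refine lintegral_congr_ae ?_
      filter_upwards [hP0] with s hs
      simp only [Pi.mul_apply]
      rw [ENNReal.mul_rpow_of_nonneg _ _ (by positivity),
        ENNReal.mul_rpow_of_nonneg _ _ (by positivity),
        ENNReal.mul_rpow_of_nonneg _ _ (by positivity), ← ENNReal.rpow_mul, ← ENNReal.rpow_mul]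
      have hPP : P s ^ (1 / q') * P s ^ (-(q - 1) * (1 / q)) = 1 := by
        rw [← ENNReal.rpow_add _ _ hs.1 hs.2, ← hqq]
        have : 1 / q' + -(q / q') * (1 / q) = 0 := by field_simp; ring
        rw [this, ENNReal.rpow_zero]
      have hkk : k t s ^ (1 / q') * k t s ^ (1 / q) = k t s := by
        rw [← ENNReal.rpow_add_of_nonneg _ _ (by positivity) (by positivity)]
        simp [hsum]
      have hgg : g s ^ (q * (1 / q)) = g s := by
        rw [mul_one_div_cancel hq0.ne', ENNReal.rpow_one]
      rw [hgg]
      calc k t s * g s = (k t s ^ (1 / q') * k t s ^ (1 / q)) *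
            (P s ^ (1 / q') * P s ^ (-(q - 1) * (1 / q))) * g s := by rw [hPP, hkk, mul_one]
        _ = _ := by ring
    have e2 := ENNReal.lintegral_mul_le_Lp_mul_Lq μ hc
      (f := fun s => (k t s * P s) ^ (1 / q'))
      (g := fun s => (k t s * (P s ^ (-(q - 1)) * g s ^ q)) ^ (1 / q))
      ((hkt.aemeasurable.mul hP).pow_const _)
      ((hkt.aemeasurable.mul ((hP.pow_const _).mul (hg.pow_const _))).pow_const _)
    rw [← e1] at e2
    simp only [← ENNReal.rpow_mul, one_div, inv_mul_cancel₀ hq'0.ne', inv_mul_cancel₀ hq0.ne',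
      ENNReal.rpow_one] at e2
    calc (∫⁻ s, k t s * g s ∂μ) ^ q ≤ ((∫⁻ s, k t s * P s ∂μ) ^ q'⁻¹ *
          (∫⁻ s, k t s * (P s ^ (-(q - 1)) * g s ^ q) ∂μ) ^ q⁻¹) ^ q := by gcongr
      _ = (∫⁻ s, k t s * P s ∂μ) ^ (q - 1) *
          (∫⁻ s, k t s * (P s ^ (-(q - 1)) * g s ^ q) ∂μ) := by
        rw [ENNReal.mul_rpow_of_nonneg _ _ hq0.le, ← ENNReal.rpow_mul, ← ENNReal.rpow_mul,
          inv_mul_cancel₀ hq0.ne', ENNReal.rpow_one, ← hqq]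
        congr 2
        field_simp
      _ ≤ (C * P t) ^ (q - 1) * (∫⁻ s, k t s * (P s ^ (-(q - 1)) * g s ^ q) ∂μ) := by
        gcongr
      _ = C ^ (q - 1) * (∫⁻ s, P t ^ (q - 1) * k t s * (P s ^ (-(q - 1)) * g s ^ q) ∂μ) := by
        rw [ENNReal.mul_rpow_of_nonneg _ _ (by linarith), mul_assoc]
        congr 1
        rw [← lintegral_const_mul' _ _ (ENNReal.rpow_ne_top_of_nonneg (by linarith) hPt.2)]
        simp only [mul_assoc]
  have hmeas : AEMeasurable (Function.uncurry fun t s =>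
      P t ^ (q - 1) * k t s * (P s ^ (-(q - 1)) * g s ^ q)) (μ.prod μ) := by
    have h1 : AEMeasurable (fun z : α × α => P z.1 ^ (q - 1)) (μ.prod μ) :=
      (hP.comp_quasiMeasurePreserving Measure.quasiMeasurePreserving_fst).pow_const _
    have h2 : AEMeasurable (fun z : α × α => P z.2 ^ (-(q - 1))) (μ.prod μ) :=
      (hP.comp_quasiMeasurePreserving Measure.quasiMeasurePreserving_snd).pow_const _
    have h3 : AEMeasurable (fun z : α × α => g z.2 ^ q) (μ.prod μ) :=
      (hg.comp_quasiMeasurePreserving Measure.quasiMeasurePreserving_snd).pow_const _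
    exact (h1.mul hk.aemeasurable).mul (h2.mul h3)
  calc ∫⁻ t, (∫⁻ s, k t s * g s ∂μ) ^ q ∂μ
      ≤ ∫⁻ t, C ^ (q - 1) *
        (∫⁻ s, P t ^ (q - 1) * k t s * (P s ^ (-(q - 1)) * g s ^ q) ∂μ) ∂μ :=
        lintegral_mono_ae key
    _ = C ^ (q - 1) *
        ∫⁻ s, ∫⁻ t, P t ^ (q - 1) * k t s * (P s ^ (-(q - 1)) * g s ^ q) ∂μ ∂μ := by
      have h := hmeas.lintegral_prod_right'
      simp only [Function.uncurry_apply_pair] at h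
      rw [lintegral_const_mul'' _ h, lintegral_lintegral_swap hmeas]
    _ ≤ C ^ (q - 1) * ∫⁻ s, C * g s ^ q ∂μ := by
      refine mul_le_mul_right ?_ _
      refine lintegral_mono_ae ?_
      filter_upwards [h₂, hP0] with s hs hPs
      have hks : Measurable fun t => k t s := hk.comp measurable_prodMk_right
      have h : AEMeasurable (fun t => P t ^ (q - 1) * k t s) μ :=
        (hP.pow_const _).mul hks.aemeasurable
      rw [lintegral_mul_const'' _ h]
      simp only [mul_comm (P _ ^ (q - 1))]
      calc _ ≤ C * P s ^ (q - 1) * (P s ^ (-(q - 1)) * g s ^ q) := by gcongr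
        _ = C * (P s ^ (q - 1) * P s ^ (-(q - 1))) * g s ^ q := by ring
        _ = C * g s ^ q := by
          rw [← ENNReal.rpow_add _ _ hPs.1 hPs.2]
          simp
    _ = C ^ q * ∫⁻ t, g t ^ q ∂μ := by
      rw [lintegral_const_mul'' _ (hg.pow_const _), ← mul_assoc]
      congr 1
      conv_lhs => rw [← ENNReal.rpow_one C, ← ENNReal.rpow_mul, mul_comm (1 : ℝ)]
      rw [mul_one, ← ENNReal.rpow_add_of_nonneg _ _ (by linarith) zero_le_one]
      congr 1
      ring

/-- Schur's test. -/
theorem eLpNorm_kernel_le {q : ℝ≥0∞} (hq : 1 < q) {k : α → α → ℝ≥0∞}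
    (hk : Measurable (Function.uncurry k)) {P : α → ℝ≥0∞} (hP : AEMeasurable P μ)
    (hP0 : ∀ᵐ t ∂μ, P t ≠ 0 ∧ P t ≠ ∞) (hP1 : q = ∞ → ∀ᵐ t ∂μ, P t = 1) {C : ℝ≥0∞}
    (h₁ : ∀ᵐ t ∂μ, ∫⁻ s, k t s * P s ∂μ ≤ C * P t)
    (h₂ : q ≠ ∞ → ∀ᵐ s ∂μ, ∫⁻ t, k t s * P t ^ (q.toReal - 1) ∂μ ≤ C * P s ^ (q.toReal - 1))
    {g : α → ℝ≥0∞} (hg : AEMeasurable g μ) :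
    eLpNorm (fun t => ∫⁻ s, k t s * g s ∂μ) q μ ≤ C * eLpNorm g q μ := by
  -- For `q = ∞` the test function is `1`, and the bound `h₁` on the integrals in `s` suffices.
  by_cases hqt : q = ∞
  · subst hqt
    simp only [eLpNorm_exponent_top]
    refine essSup_le_of_ae_le _ ?_
    filter_upwards [h₁, hP1 rfl] with t ht hPt
    rw [enorm_eq_self]
    rw [hPt, mul_one] at ht
    have hkt : Measurable (k t) := hk.comp measurable_prodMk_left
    calc ∫⁻ s, k t s * g s ∂μ ≤ ∫⁻ s, k t s * P s * eLpNormEssSup g μ ∂μ := by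
          refine lintegral_mono_ae ?_
          filter_upwards [hP1 rfl, enorm_ae_le_eLpNormEssSup g μ] with s hs hgs
          rw [hs, mul_one]
          gcongr
          simpa using hgs
      _ = (∫⁻ s, k t s * P s ∂μ) * eLpNormEssSup g μ :=
        lintegral_mul_const'' _ (hkt.aemeasurable.mul hP)
      _ ≤ _ := by gcongr
  · have h1 := one_lt_toReal hq hqt
    have hq0 : 0 < q.toReal := by linarith
    rw [eLpNorm_eq_lintegral_rpow_enorm_toReal (by positivity) hqt,
      eLpNorm_eq_lintegral_rpow_enorm_toReal (by positivity) hqt]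
    simp only [enorm_eq_self]
    calc _ ≤ (C ^ q.toReal * ∫⁻ t, g t ^ q.toReal ∂μ) ^ (1 / q.toReal) := by
          gcongr
          exact lintegral_rpow_kernel_le h1 hk hP hP0 h₁ (h₂ hqt) hg
      _ = _ := by
        rw [ENNReal.mul_rpow_of_nonneg _ _ (by positivity), ← ENNReal.rpow_mul,
          mul_one_div_cancel hq0.ne', ENNReal.rpow_one]

end Schur

/-! ### The primitive of the weight measure -/

section distribution

variable {r : ℝ} {v : ℝ → ℝ}

/-- The function `x ↦ ∫_0^x t⁻¹ v(t)⁻ʳ dt`. -/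
noncomputable def weightPrimitive (r : ℝ) (v : ℝ → ℝ) (x : ℝ) : ℝ :=
  (weightMeasure r v).real (Ioc 0 x)

/-- The Potter bound keeps `v` away from `0` on `(s,t]`, so the density is bounded there. -/
theorem SlowlyVarying.weightMeasure_Ioc_lt_top (hv : SlowlyVarying v) (hr : 0 ≤ r) {s t : ℝ}
    (hs : 0 < s) : weightMeasure r v (Ioc s t) < ∞ := by
  obtain ⟨c, hc, hb⟩ := hv.exists_bound
  have hsub : Ioc s t ⊆ Ioi 0 := fun x hx => hs.trans hx.1
  rw [weightMeasure_apply hv.measurable measurableSet_Ioc hsub]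
  have hvs := hv.pos s hs
  set M : ℝ := s⁻¹ * (v s / (c * (t / s) ^ (1 / 2 : ℝ))) ^ (-r)
  calc ∫⁻ x in Ioc s t, ENNReal.ofReal (x⁻¹ * v x ^ (-r))
      ≤ ∫⁻ x in Ioc s t, ENNReal.ofReal M := by
        refine setLIntegral_mono measurable_const fun x hx => ?_
        have hx0 : 0 < x := hsub hx
        have ht : 0 < t := hx0.trans_le hx.2
        have hvx := hv.pos x hx0
        refine ENNReal.ofReal_le_ofReal ?_
        have h1 : v s ≤ c * (t / s) ^ (1 / 2 : ℝ) * v x := by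
          refine (hb s x hs hx.1.le).1.trans ?_
          have := hx.2
          gcongr
        have h2 : v s / (c * (t / s) ^ (1 / 2 : ℝ)) ≤ v x := by
          rw [div_le_iff₀ (by positivity)]
          linarith
        have h3 := Real.rpow_le_rpow_of_nonpos (by positivity) h2 (neg_nonpos.2 hr)
        have h4 : x⁻¹ ≤ s⁻¹ := inv_anti₀ hs hx.1.le
        exact mul_le_mul h4 h3 (by positivity) (by positivity)
    _ < ∞ := by simp [ENNReal.mul_lt_top_iff]

theorem SlowlyVarying.weightMeasure_Ioc_zero_lt_top (hv : SlowlyVarying v) (hr : 0 ≤ r)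
    (h1 : weightMeasure r v (Ioc 0 1) < ∞) (t : ℝ) : weightMeasure r v (Ioc 0 t) < ∞ := by
  refine (measure_mono (t := Ioc 0 1 ∪ Ioc 1 t) fun x hx => ?_).trans_lt
    ((measure_union_le _ _).trans_lt
      (ENNReal.add_lt_top.2 ⟨h1, hv.weightMeasure_Ioc_lt_top hr one_pos⟩))
  rcases le_or_gt x 1 with h | h
  · exact Or.inl ⟨hx.1, h⟩
  · exact Or.inr ⟨h, hx.2⟩

variable (hv0 : ∀ t ∈ Ioi (0 : ℝ), 0 < v t) (hv : AEMeasurable v (volume.restrict (Ioi 0)))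
  (hfin : ∀ t : ℝ, weightMeasure r v (Ioc 0 t) < ∞)

include hfin in
theorem ofReal_weightPrimitive (t : ℝ) :
    ENNReal.ofReal (weightPrimitive r v t) = weightMeasure r v (Ioc 0 t) :=
  ENNReal.ofReal_toReal (hfin t).ne

theorem weightPrimitive_of_nonpos {t : ℝ} (ht : t ≤ 0) : weightPrimitive r v t = 0 := by
  simp [weightPrimitive, Ioc_eq_empty_of_le ht]

theorem weightPrimitive_nonneg (t : ℝ) : 0 ≤ weightPrimitive r v t := measureReal_nonneg

include hfin in
theorem weightPrimitive_mono : Monotone (weightPrimitive r v) := fun _ t hst =>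
  measureReal_mono (Ioc_subset_Ioc_right hst) (hfin t).ne

include hfin in
theorem weightPrimitive_sub {s t : ℝ} (hs : 0 ≤ s) (hst : s ≤ t) :
    (weightMeasure r v).real (Ioc s t) = weightPrimitive r v t - weightPrimitive r v s := by
  have h : (weightMeasure r v).real (Ioc 0 s ∪ Ioc s t) = _ :=
    measureReal_union (Ioc_disjoint_Ioc_of_le le_rfl) measurableSet_Ioc (hfin s).ne
      ((measure_mono (Ioc_subset_Ioc_left hs)).trans_lt (hfin t)).ne
  rw [Ioc_union_Ioc_eq_Ioc hs hst] at h
  simp only [weightPrimitive, h]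
  ring

include hv0 hv in
theorem weightMeasure_Ioc_pos {s t : ℝ} (hs : 0 ≤ s) (hst : s < t) :
    0 < weightMeasure r v (Ioc s t) := by
  refine pos_iff_ne_zero.2 fun h => ?_
  have := absolutelyContinuous_weightMeasure (r := r) hv0 hv h
  rw [Measure.restrict_apply measurableSet_Ioc,
    inter_eq_self_of_subset_left
      (show Ioc s t ⊆ Ioi 0 from fun x hx => hs.trans_lt hx.1)] at this
  simp at this
  linarith

include hv0 hv hfin in
theorem weightPrimitive_strictMonoOn : StrictMonoOn (weightPrimitive r v) (Ici 0) := by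
  intro s hs t _ hst
  have h := weightPrimitive_sub hfin hs hst.le
  have h1 := weightMeasure_Ioc_pos (r := r) hv0 hv hs hst
  have h2 : 0 < (weightMeasure r v).real (Ioc s t) :=
    ENNReal.toReal_pos h1.ne' ((measure_mono (Ioc_subset_Ioc_left hs)).trans_lt (hfin t)).ne
  linarith

include hv0 hv hfin in
theorem weightPrimitive_pos {t : ℝ} (ht : 0 < t) : 0 < weightPrimitive r v t := by
  have := weightPrimitive_strictMonoOn hv0 hv hfin self_mem_Ici (mem_Ici.2 ht.le) ht
  rwa [weightPrimitive_of_nonpos le_rfl] at this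

include hfin in
theorem weightPrimitive_continuousOn (T : ℝ) :
    ContinuousOn (weightPrimitive r v) (Icc 0 T) := by
  have h : IntegrableOn (fun _ => (1 : ℝ)) (Icc 0 T) (weightMeasure r v) := by
    rw [integrableOn_Icc_iff_integrableOn_Ioc, integrableOn_const_iff]
    exact Or.inr (hfin T)
  refine (intervalIntegral.continuousOn_primitive h).congr fun t _ => ?_
  simp [weightPrimitive]

include hfin in
theorem exists_weightPrimitive_eq {T y : ℝ} (hT : 0 ≤ T) (hy : 0 ≤ y)
    (hyT : y ≤ weightPrimitive r v T) : ∃ s ∈ Icc 0 T, weightPrimitive r v s = y := by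
  have := intermediate_value_Icc hT (weightPrimitive_continuousOn hfin T)
  rw [weightPrimitive_of_nonpos le_rfl] at this
  exact this ⟨hy, hyT⟩

include hv0 hv hfin in
/-- The primitive transports the weight measure to Lebesgue measure. -/
theorem map_weightPrimitive {T : ℝ} (hT : 0 ≤ T) :
    ((weightMeasure r v).restrict (Ioc 0 T)).map (weightPrimitive r v) =
      volume.restrict (Ioc 0 (weightPrimitive r v T)) := by
  have hmeas := (weightPrimitive_mono hfin).measurable
  have : IsFiniteMeasure ((weightMeasure r v).restrict (Ioc 0 T)) := ⟨by simpa using hfin T⟩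
  have : IsFiniteMeasure
    (((weightMeasure r v).restrict (Ioc 0 T)).map (weightPrimitive r v)) := inferInstance
  have hmono := weightPrimitive_strictMonoOn hv0 hv hfin
  -- Finite measures on the line are determined by half-lines. A level `y` in the range of the
  -- primitive is attained at some `s`, and strict monotonicity identifies the sublevel set with
  -- `(0,s]`.
  refine Measure.ext_of_Iic _ _ fun y => ?_
  rw [Measure.map_apply hmeas measurableSet_Iic,
    Measure.restrict_apply (hmeas measurableSet_Iic), Measure.restrict_apply measurableSet_Iic]
  rcases lt_or_ge y 0 with hy | hy
  · have e1 : weightPrimitive r v ⁻¹' Iic y ∩ Ioc 0 T = ∅ :=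
      eq_empty_of_forall_notMem fun t ht =>
        (lt_irrefl (0 : ℝ)) (((weightPrimitive_nonneg t).trans ht.1).trans_lt hy)
    have e2 : Iic y ∩ Ioc 0 (weightPrimitive r v T) = ∅ :=
      eq_empty_of_forall_notMem fun t ht =>
        (lt_irrefl (0 : ℝ)) ((ht.2.1.le.trans ht.1).trans_lt hy)
    simp [e1, e2]
  rcases le_or_gt (weightPrimitive r v T) y with hyT | hyT
  · have e1 : weightPrimitive r v ⁻¹' Iic y ∩ Ioc 0 T = Ioc 0 T :=
      inter_eq_self_of_subset_right fun t ht => (weightPrimitive_mono hfin ht.2).trans hyT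
    have e2 : Iic y ∩ Ioc 0 (weightPrimitive r v T) = Ioc 0 (weightPrimitive r v T) :=
      inter_eq_self_of_subset_right fun t ht => ht.2.trans hyT
    rw [e1, e2, ← ofReal_weightPrimitive hfin]
    simp
  · obtain ⟨s, hs, rfl⟩ := exists_weightPrimitive_eq hfin hT hy hyT.le
    have e1 : weightPrimitive r v ⁻¹' Iic (weightPrimitive r v s) ∩ Ioc 0 T = Ioc 0 s := by
      ext t
      constructor
      · rintro ⟨h1, h2⟩
        exact ⟨h2.1, (hmono.le_iff_le (mem_Ici.2 h2.1.le) (mem_Ici.2 hs.1)).1 h1⟩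
      · rintro ⟨h1, h2⟩
        exact ⟨weightPrimitive_mono hfin h2, h1, h2.trans hs.2⟩
    have e2 : Iic (weightPrimitive r v s) ∩ Ioc 0 (weightPrimitive r v T) =
        Ioc 0 (weightPrimitive r v s) := by
      ext t
      constructor
      · rintro ⟨h1, h2⟩
        exact ⟨h2.1, h1⟩
      · rintro ⟨h1, h2⟩
        exact ⟨h2, h1, h2.trans hyT.le⟩
    rw [e1, e2, ← ofReal_weightPrimitive hfin]
    simp

include hv0 hv hfin in
theorem setLIntegral_comp_weightPrimitive {T : ℝ} (hT : 0 ≤ T) {F : ℝ → ℝ≥0∞}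
    (hF : Measurable F) : ∫⁻ t in Ioc 0 T, F (weightPrimitive r v t) ∂weightMeasure r v =
      ∫⁻ y in Ioc 0 (weightPrimitive r v T), F y := by
  rw [← map_weightPrimitive hv0 hv hfin hT,
    lintegral_map hF (weightPrimitive_mono hfin).measurable]

include hv0 hv hfin in
-- The substitution `y = W(t)` leaves the integral of `y^{-β}` over `(0, W(T)]`.
theorem setLIntegral_weightPrimitive_rpow_Ioc {β : ℝ} (hβ : β < 1) {T : ℝ} (hT : 0 < T) :
    ∫⁻ t in Ioc 0 T, ENNReal.ofReal (weightPrimitive r v t ^ (-β)) ∂weightMeasure r v =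
      ENNReal.ofReal (weightPrimitive r v T ^ (1 - β) / (1 - β)) := by
  have hW := weightPrimitive_pos hv0 hv hfin hT
  rw [setLIntegral_comp_weightPrimitive (F := fun y => ENNReal.ofReal (y ^ (-β))) hv0 hv hfin hT.le
    (measurable_id.pow_const _).ennreal_ofReal]
  have hi := intervalIntegral.intervalIntegrable_rpow' (a := 0) (b := weightPrimitive r v T)
    (show -1 < -β by linarith)
  rw [intervalIntegrable_iff_integrableOn_Ioc_of_le hW.le] at hi
  rw [← ofReal_integral_eq_lintegral_ofReal hi, ← intervalIntegral.integral_of_le hW.le,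
    integral_rpow (Or.inl (by linarith)), Real.zero_rpow (by linarith), sub_zero,
    neg_add_eq_sub]
  filter_upwards [ae_restrict_mem measurableSet_Ioc] with y hy
  exact Real.rpow_nonneg hy.1.le _

include hv0 hv hfin in
-- The same substitution on `[s, s+n]`, then a monotone limit in `n`. In general only an inequality
-- holds, since `W` may be bounded.
theorem setLIntegral_weightPrimitive_rpow_Ici {γ : ℝ} (hγ : 1 < γ) {s : ℝ} (hs : 0 < s) :
    ∫⁻ t in Ici s, ENNReal.ofReal (weightPrimitive r v t ^ (-γ)) ∂weightMeasure r v ≤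
      ENNReal.ofReal (weightPrimitive r v s ^ (1 - γ) / (γ - 1)) := by
  have hW := weightPrimitive_pos hv0 hv hfin hs
  have hbound : ∀ n : ℕ, ∫⁻ t in Icc s (s + n), ENNReal.ofReal (weightPrimitive r v t ^ (-γ))
      ∂weightMeasure r v ≤ ENNReal.ofReal (weightPrimitive r v s ^ (1 - γ) / (γ - 1)) := by
    intro n
    have hsn : 0 ≤ s + n := by positivity
    calc ∫⁻ t in Icc s (s + n), ENNReal.ofReal (weightPrimitive r v t ^ (-γ)) ∂weightMeasure r v
        = ∫⁻ t in Icc s (s + n), (Ici (weightPrimitive r v s)).indicator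
          (fun y => ENNReal.ofReal (y ^ (-γ))) (weightPrimitive r v t) ∂weightMeasure r v := by
          refine setLIntegral_congr_fun measurableSet_Icc fun t ht => ?_
          rw [indicator_of_mem]
          exact weightPrimitive_mono hfin ht.1
      _ ≤ ∫⁻ t in Ioc 0 (s + n), (Ici (weightPrimitive r v s)).indicator
          (fun y => ENNReal.ofReal (y ^ (-γ))) (weightPrimitive r v t) ∂weightMeasure r v :=
          lintegral_mono_set fun t ht => ⟨hs.trans_le ht.1, ht.2⟩
      _ = ∫⁻ y in Ioc 0 (weightPrimitive r v (s + n)), (Ici (weightPrimitive r v s)).indicator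
          (fun y => ENNReal.ofReal (y ^ (-γ))) y :=
          setLIntegral_comp_weightPrimitive hv0 hv hfin hsn
            ((measurable_id.pow_const _).ennreal_ofReal.indicator measurableSet_Ici)
      _ ≤ ∫⁻ y, (Ici (weightPrimitive r v s)).indicator
          (fun y => ENNReal.ofReal (y ^ (-γ))) y := setLIntegral_le_lintegral _ _
      _ = ∫⁻ y in Ioi (weightPrimitive r v s), ENNReal.ofReal (y ^ (-γ)) := by
        rw [lintegral_indicator measurableSet_Ici, restrict_Ioi_eq_restrict_Ici]
      _ = _ := by
        rw [← ofReal_integral_eq_lintegral_ofReal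
          (integrableOn_Ioi_rpow_of_lt (by linarith) hW), integral_Ioi_rpow_of_lt (by linarith) hW]
        · congr 1
          rw [neg_div, ← div_neg]
          congr 1 <;> ring_nf
        · filter_upwards [ae_restrict_mem measurableSet_Ioi] with y hy
          exact Real.rpow_nonneg (hW.trans hy).le _
  have hU : Ici s = ⋃ n : ℕ, Icc s (s + n) := by
    ext t
    simp only [mem_Ici, mem_iUnion, mem_Icc]
    refine ⟨fun h => ?_, fun ⟨n, h⟩ => h.1⟩
    obtain ⟨n, hn⟩ := exists_nat_ge (t - s)
    exact ⟨n, h, by linarith⟩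
  rw [hU, setLIntegral_iUnion_of_directed]
  · exact iSup_le hbound
  · refine Monotone.directed_le fun m n hmn => Icc_subset_Icc_right ?_
    gcongr

/-- `W(t)` is at least the mass of `(t/2, t]`. On this interval the Potter bound keeps the density
above a multiple of `t⁻¹ v(t)^{-r}`, and its length is `t/2`. -/
theorem SlowlyVarying.exists_inv_weightPrimitive_le (hv : SlowlyVarying v) (hr : 0 ≤ r)
    (h1 : weightMeasure r v (Ioc 0 1) < ∞) :
    ∃ c : ℝ, 0 < c ∧ ∀ t, 0 < t → (weightPrimitive r v t)⁻¹ ≤ c * v t ^ r := by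
  obtain ⟨c, hc, hb⟩ := hv.exists_bound
  have hfin := hv.weightMeasure_Ioc_zero_lt_top hr h1
  refine ⟨2 * (c * 2 ^ (1 / 2 : ℝ)) ^ r, by positivity, fun t ht => ?_⟩
  have hvt := hv.pos t ht
  set m : ℝ := t⁻¹ * (c * 2 ^ (1 / 2 : ℝ) * v t) ^ (-r) with hm
  have hsub : Ioc (t / 2) t ⊆ Ioi 0 := fun x hx => (half_pos ht).trans hx.1
  have hlow : ENNReal.ofReal (m * (t / 2)) ≤ ENNReal.ofReal (weightPrimitive r v t) := by
    rw [ofReal_weightPrimitive hfin]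
    calc ENNReal.ofReal (m * (t / 2)) = ∫⁻ x in Ioc (t / 2) t, ENNReal.ofReal m := by
          rw [setLIntegral_const, Real.volume_Ioc, ← ENNReal.ofReal_mul (by positivity)]
          congr 2
          ring
      _ ≤ ∫⁻ x in Ioc (t / 2) t, ENNReal.ofReal (x⁻¹ * v x ^ (-r)) := by
        refine setLIntegral_mono_ae' measurableSet_Ioc (ae_of_all _ fun x hx => ?_)
        have hx0 : 0 < x := hsub hx
        have hvx := hv.pos x hx0
        refine ENNReal.ofReal_le_ofReal ?_
        have h3 : v x ≤ c * 2 ^ (1 / 2 : ℝ) * v t := by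
          refine (hb x t hx0 hx.2).1.trans ?_
          have : t / x ≤ 2 := by
            rw [div_le_iff₀ hx0]
            linarith [hx.1]
          gcongr
        have h4 := Real.rpow_le_rpow_of_nonpos hvx h3 (neg_nonpos.2 hr)
        exact mul_le_mul (inv_anti₀ hx0 hx.2) h4 (by positivity) (by positivity)
      _ = weightMeasure r v (Ioc (t / 2) t) :=
        (weightMeasure_apply hv.measurable measurableSet_Ioc hsub).symm
      _ ≤ _ := measure_mono (Ioc_subset_Ioc_left (half_pos ht).le)
  have hlow' := (ENNReal.ofReal_le_ofReal_iff (weightPrimitive_nonneg t)).1 hlow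
  have hpos : 0 < m * (t / 2) := by positivity
  refine (inv_anti₀ hpos hlow').trans_eq ?_
  rw [hm, Real.rpow_neg (by positivity), Real.mul_rpow (by positivity) hvt.le]
  have := Real.rpow_pos_of_pos hvt r
  have h5 : 0 < (c * 2 ^ (1 / 2 : ℝ)) ^ r := by positivity
  field_simp

end distribution

/-! ### Hardy inequalities for averages and tails -/

section Hardy

variable {q q' : ℝ≥0∞} {v : ℝ → ℝ}

/-- Hardy's inequality for the averages with respect to `weightMeasure`. -/
theorem eLpNorm_average_le (hq : 1 < q) (hqq' : q⁻¹ + q'⁻¹ = 1) (hv : SlowlyVarying v)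
    (hfin : ∀ t : ℝ, weightMeasure q'.toReal v (Ioc 0 t) < ∞) {g : ℝ → ℝ≥0∞}
    (hg : AEMeasurable g (weightMeasure q'.toReal v)) :
    eLpNorm (fun t => ENNReal.ofReal (weightPrimitive q'.toReal v t)⁻¹ *
      ∫⁻ s in Ioc 0 t, g s ∂weightMeasure q'.toReal v) q (weightMeasure q'.toReal v) ≤
      ENNReal.ofReal q'.toReal * eLpNorm g q (weightMeasure q'.toReal v) := by
  set r := q'.toReal with hr
  have hr1 : 1 ≤ r := one_le_conj_toReal hq hqq'
  have hconj : q.toReal⁻¹ + r⁻¹ = 1 := conj_inv_toReal hqq'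
  have hr0 : 0 < r⁻¹ := by positivity
  set W := weightPrimitive r v with hW
  have hWm : Measurable W := (weightPrimitive_mono hfin).measurable
  have hWpos : ∀ t, 0 < t → 0 < W t := fun t ht =>
    weightPrimitive_pos hv.pos hv.measurable hfin ht
  -- The test function is `W^{-β}`, and `1 - β = 1/q'` produces the constant `q'` in both conditions
  -- of Schur's test. For `q = ∞` the default value `toReal ∞ = 0` gives `β = 0`, hence test
  -- function `1` as required.
  set β : ℝ := q.toReal⁻¹ with hβ
  have hβ1 : β < 1 := by linarith
  let k : ℝ → ℝ → ℝ≥0∞ := fun t s =>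
    {z : ℝ × ℝ | 0 < z.2 ∧ z.2 ≤ z.1}.indicator (fun z => ENNReal.ofReal (W z.1)⁻¹) (t, s)
  have hset : MeasurableSet {z : ℝ × ℝ | 0 < z.2 ∧ z.2 ≤ z.1} :=
    (measurableSet_lt measurable_const measurable_snd).inter
      (measurableSet_le measurable_snd measurable_fst)
  have hk : Measurable (Function.uncurry k) :=
    (hWm.comp measurable_fst).inv.ennreal_ofReal.indicator hset
  have hk1 : ∀ t (h : ℝ → ℝ≥0∞), ∫⁻ s, k t s * h s ∂weightMeasure r v =
      ENNReal.ofReal (W t)⁻¹ * ∫⁻ s in Ioc 0 t, h s ∂weightMeasure r v := by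
    intro t h
    rw [← lintegral_const_mul' _ _ ENNReal.ofReal_ne_top, ← lintegral_indicator measurableSet_Ioc]
    refine lintegral_congr fun s => ?_
    by_cases hs : s ∈ Ioc 0 t
    · have : (t, s) ∈ {z : ℝ × ℝ | 0 < z.2 ∧ z.2 ≤ z.1} := hs
      simp only [k, indicator_of_mem this, indicator_of_mem hs]
    · have : (t, s) ∉ {z : ℝ × ℝ | 0 < z.2 ∧ z.2 ≤ z.1} := hs
      simp only [k, indicator_of_notMem this, indicator_of_notMem hs, zero_mul]
  simp only [← hk1]
  refine eLpNorm_kernel_le (P := fun t => ENNReal.ofReal (W t ^ (-β))) hq hk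
    (hWm.pow_const _).ennreal_ofReal.aemeasurable ?_ ?_ ?_ ?_ hg
  · refine ae_weightMeasure_of_forall fun t ht => ⟨?_, ENNReal.ofReal_ne_top⟩
    have := Real.rpow_pos_of_pos (hWpos t ht) (-β)
    simpa using this
  · intro hqt
    simp [hβ, hqt]
  · refine ae_weightMeasure_of_forall fun t ht => le_of_eq ?_
    have hWt := hWpos t ht
    rw [hk1, setLIntegral_weightPrimitive_rpow_Ioc hv.pos hv.measurable hfin hβ1 ht,
      ← ENNReal.ofReal_mul (by positivity), ← ENNReal.ofReal_mul (by positivity)]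
    congr 1
    have : 1 - β = r⁻¹ := by linarith
    rw [this, div_inv_eq_mul, ← this, sub_eq_add_neg, Real.rpow_add hWt, Real.rpow_one]
    field_simp
  · intro hqt
    have hq1 := one_lt_toReal hq hqt
    refine ae_weightMeasure_of_forall fun s hs => ?_
    have hWs := hWpos s hs
    have hexp : -β * (q.toReal - 1) = -(1 - β) := by
      rw [hβ]; field_simp
    have hPq : ∀ t, 0 < t → ENNReal.ofReal (W t ^ (-β)) ^ (q.toReal - 1) =
        ENNReal.ofReal (W t ^ (-(1 - β))) := fun t ht => by
      rw [ENNReal.ofReal_rpow_of_nonneg (Real.rpow_nonneg (hWpos t ht).le _) (by linarith),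
        ← Real.rpow_mul (hWpos t ht).le, hexp]
    calc ∫⁻ t, k t s * ENNReal.ofReal (W t ^ (-β)) ^ (q.toReal - 1) ∂weightMeasure r v
        = ∫⁻ t in Ici s, ENNReal.ofReal (W t ^ (-(2 - β))) ∂weightMeasure r v := by
          rw [← lintegral_indicator measurableSet_Ici]
          refine lintegral_congr fun t => ?_
          by_cases ht : t ∈ Ici s
          · have h1 : (t, s) ∈ {z : ℝ × ℝ | 0 < z.2 ∧ z.2 ≤ z.1} := ⟨hs, ht⟩
            have ht0 : 0 < t := hs.trans_le ht
            have hWt := hWpos t ht0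
            simp only [k, indicator_of_mem h1, indicator_of_mem ht]
            rw [hPq t ht0, ← ENNReal.ofReal_mul (by positivity), ← Real.rpow_neg_one,
              ← Real.rpow_add hWt]
            congr 2
            ring
          · have h1 : (t, s) ∉ {z : ℝ × ℝ | 0 < z.2 ∧ z.2 ≤ z.1} := fun h => ht h.2
            simp only [k, indicator_of_notMem h1, indicator_of_notMem ht, zero_mul]
      _ ≤ ENNReal.ofReal (W s ^ (1 - (2 - β)) / (2 - β - 1)) :=
        setLIntegral_weightPrimitive_rpow_Ici hv.pos hv.measurable hfin (by linarith) hs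
      _ = ENNReal.ofReal r * ENNReal.ofReal (W s ^ (-β)) ^ (q.toReal - 1) := by
        rw [hPq s hs, ← ENNReal.ofReal_mul (by positivity)]
        congr 1
        have h1 : 2 - β - 1 = r⁻¹ := by linarith
        have h2 : 1 - (2 - β) = -(1 - β) := by ring
        rw [h1, h2, div_inv_eq_mul, mul_comm]

/-- Hardy's inequality for the tails. -/
theorem exists_eLpNorm_tail_le (hq : 1 < q) (hqq' : q⁻¹ + q'⁻¹ = 1) (hv : SlowlyVarying v)
    (h1 : weightMeasure q'.toReal v (Ioc 0 1) < ∞) :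
    ∃ c : ℝ, ∀ g : ℝ → ℝ≥0∞, AEMeasurable g (weightMeasure q'.toReal v) →
    eLpNorm (fun t => ENNReal.ofReal (weightPrimitive q'.toReal v t)⁻¹ *
      (ENNReal.ofReal t * ∫⁻ s in Ioi t, ENNReal.ofReal s⁻¹ * g s ∂weightMeasure q'.toReal v)) q
      (weightMeasure q'.toReal v) ≤
      ENNReal.ofReal c * eLpNorm g q (weightMeasure q'.toReal v) := by
  set r := q'.toReal with hr
  have hr1 : 1 ≤ r := one_le_conj_toReal hq hqq'
  have hconj : q.toReal⁻¹ + r⁻¹ = 1 := conj_inv_toReal hqq'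
  have hr0 : 0 < r⁻¹ := by positivity
  have hfin := hv.weightMeasure_Ioc_zero_lt_top (zero_le_one.trans hr1) h1
  set W := weightPrimitive r v with hW
  have hWm : Measurable W := (weightPrimitive_mono hfin).measurable
  have hWpos : ∀ t, 0 < t → 0 < W t := fun t ht =>
    weightPrimitive_pos hv.pos hv.measurable hfin ht
  obtain ⟨c₁, hc₁, hb⟩ := hv.exists_bound
  obtain ⟨c₂, hc₂, hWb⟩ := hv.exists_inv_weightPrimitive_le (zero_le_one.trans hr1) h1
  refine ⟨2 * c₁ * c₂, fun g hg => ?_⟩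
  let k : ℝ → ℝ → ℝ≥0∞ := fun t s => {z : ℝ × ℝ | 0 < z.1 ∧ z.1 < z.2}.indicator
    (fun z => ENNReal.ofReal (W z.1)⁻¹ * (ENNReal.ofReal z.1 * ENNReal.ofReal z.2⁻¹)) (t, s)
  have hset : MeasurableSet {z : ℝ × ℝ | 0 < z.1 ∧ z.1 < z.2} :=
    (measurableSet_lt measurable_const measurable_fst).inter
      (measurableSet_lt measurable_fst measurable_snd)
  have hk : Measurable (Function.uncurry k) :=
    ((hWm.comp measurable_fst).inv.ennreal_ofReal.mul
      (measurable_fst.ennreal_ofReal.mul measurable_snd.inv.ennreal_ofReal)).indicator hset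
  have hk1 : ∀ t, 0 < t → ∀ (h : ℝ → ℝ≥0∞), ∫⁻ s, k t s * h s ∂weightMeasure r v =
      ENNReal.ofReal (W t)⁻¹ *
        (ENNReal.ofReal t * ∫⁻ s in Ioi t, ENNReal.ofReal s⁻¹ * h s ∂weightMeasure r v) := by
    intro t ht0 h
    rw [← lintegral_const_mul' _ _ ENNReal.ofReal_ne_top,
      ← lintegral_const_mul' _ _ ENNReal.ofReal_ne_top, ← lintegral_indicator measurableSet_Ioi]
    refine lintegral_congr fun s => ?_
    by_cases hs : s ∈ Ioi t
    · have : (t, s) ∈ {z : ℝ × ℝ | 0 < z.1 ∧ z.1 < z.2} := ⟨ht0, hs⟩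
      simp only [k, indicator_of_mem this, indicator_of_mem hs]
      ring
    · have : (t, s) ∉ {z : ℝ × ℝ | 0 < z.1 ∧ z.1 < z.2} := fun h => hs h.2
      simp only [k, indicator_of_notMem this, indicator_of_notMem hs, zero_mul]
  have hae : ∀ᵐ t ∂weightMeasure r v, ENNReal.ofReal (W t)⁻¹ *
      (ENNReal.ofReal t * ∫⁻ s in Ioi t, ENNReal.ofReal s⁻¹ * g s ∂weightMeasure r v) =
      ∫⁻ s, k t s * g s ∂weightMeasure r v :=
    ae_weightMeasure_of_forall fun t ht => (hk1 t ht g).symm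
  rw [eLpNorm_congr_ae hae]
  -- With test function `v^{r-1}` the integral in `s` becomes `∫_t^∞ s⁻² v(s)⁻¹ ds`, which is at
  -- most a multiple of `t⁻¹ v(t)⁻¹` by Potter; then `W⁻¹ ≲ v^r` restores `v^{r-1}`. As `(r-1)(q-1)
  -- = 1` for finite `q`, the dual condition has test function `v` and reduces to `s⁻¹ ∫_0^s v(t) dt
  -- ≲ v(s)`. For `q = ∞`, `r = 1` and the test function is `1`.
  refine eLpNorm_kernel_le (P := fun t => ENNReal.ofReal (v t ^ (r - 1))) hq hk
    ((hv.measurable.pow_const _).ennreal_ofReal.mono_ac weightMeasure_absolutelyContinuous)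
    ?_ ?_ ?_ ?_ hg
  · refine ae_weightMeasure_of_forall fun t ht => ⟨?_, ENNReal.ofReal_ne_top⟩
    have := Real.rpow_pos_of_pos (hv.pos t ht) (r - 1)
    simpa using this
  · intro hqt
    have : r = 1 := by simpa [hqt] using hconj
    simp [this]
  · refine ae_weightMeasure_of_forall fun t ht => ?_
    have hWt := hWpos t ht
    have hvt := hv.pos t ht
    rw [hk1 t ht, setLIntegral_weightMeasure hv.measurable measurableSet_Ioi
      (fun s hs => ht.trans hs)]
    have hint : ∫⁻ s in Ioi t, ENNReal.ofReal (s⁻¹ * v s ^ (-r)) *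
        (ENNReal.ofReal s⁻¹ * ENNReal.ofReal (v s ^ (r - 1))) ≤
        ENNReal.ofReal (2 * c₁ * t⁻¹ * (v t)⁻¹) := by
      calc _ ≤ ∫⁻ s in Ioi t, ENNReal.ofReal (c₁ * t ^ (-(1 / 2) : ℝ) * (v t)⁻¹ *
            s ^ (-(3 / 2) : ℝ)) := by
            refine setLIntegral_mono_ae' measurableSet_Ioi (ae_of_all _ fun s hs => ?_)
            have hs0 : 0 < s := ht.trans hs
            have hvs := hv.pos s hs0
            rw [← ENNReal.ofReal_mul (by positivity), ← ENNReal.ofReal_mul (by positivity)]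
            refine ENNReal.ofReal_le_ofReal ?_
            have hb1 := (hb t s ht (le_of_lt hs)).1
            rw [Real.div_rpow hs0.le ht.le] at hb1
            have hinv : (v s)⁻¹ ≤ c₁ * (s ^ (1 / 2 : ℝ) / t ^ (1 / 2 : ℝ)) * (v t)⁻¹ := by
              rw [inv_le_iff_one_le_mul₀ hvs]
              calc (1 : ℝ) = v t * (v t)⁻¹ := by field_simp
                _ ≤ c₁ * (s ^ (1 / 2 : ℝ) / t ^ (1 / 2 : ℝ)) * v s * (v t)⁻¹ := by gcongr
                _ = _ := by ring
            have e1 : v s ^ (-r) * v s ^ (r - 1) = (v s)⁻¹ := by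
              rw [← Real.rpow_add hvs, ← Real.rpow_neg_one]
              congr 1
              ring
            have e2 : s⁻¹ * s⁻¹ * s ^ (1 / 2 : ℝ) = s ^ (-(3 / 2) : ℝ) := by
              rw [← Real.rpow_neg_one, ← Real.rpow_add hs0, ← Real.rpow_add hs0]
              norm_num
            have e3 : t ^ (-(1 / 2) : ℝ) = (t ^ (1 / 2 : ℝ))⁻¹ := Real.rpow_neg ht.le _
            calc s⁻¹ * v s ^ (-r) * (s⁻¹ * v s ^ (r - 1))
                = s⁻¹ * s⁻¹ * (v s ^ (-r) * v s ^ (r - 1)) := by ring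
              _ ≤ s⁻¹ * s⁻¹ * (c₁ * (s ^ (1 / 2 : ℝ) / t ^ (1 / 2 : ℝ)) * (v t)⁻¹) := by
                rw [e1]; gcongr
              _ = _ := by rw [← e2, e3]; ring
        _ = ENNReal.ofReal (2 * c₁ * t⁻¹ * (v t)⁻¹) := by
          rw [← ofReal_integral_eq_lintegral_ofReal
            ((integrableOn_Ioi_rpow_of_lt (by norm_num) ht).const_mul _)
            (by
              filter_upwards [ae_restrict_mem measurableSet_Ioi] with s hs
              have hs0 : 0 < s := ht.trans hs
              simp only [Pi.zero_apply]
              positivity),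
            integral_const_mul, integral_Ioi_rpow_of_lt (by norm_num) ht]
          congr 1
          have e4 : t ^ (-(1 / 2) : ℝ) * t ^ (-(3 / 2) + 1 : ℝ) = t⁻¹ := by
            rw [← Real.rpow_neg_one, ← Real.rpow_add ht]
            norm_num
          rw [← e4]
          ring
    calc _ ≤ ENNReal.ofReal (c₂ * v t ^ r) *
          (ENNReal.ofReal t * ENNReal.ofReal (2 * c₁ * t⁻¹ * (v t)⁻¹)) := by
          gcongr
          exact hWb t ht
      _ = ENNReal.ofReal (2 * c₁ * c₂) * ENNReal.ofReal (v t ^ (r - 1)) := by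
        rw [← ENNReal.ofReal_mul (by positivity), ← ENNReal.ofReal_mul (by positivity),
          ← ENNReal.ofReal_mul (by positivity)]
        congr 1
        rw [Real.rpow_sub_one hvt.ne']
        field_simp
  · intro hqt
    have hc := holderConjugate_toReal hq hqq' hqt
    refine ae_weightMeasure_of_forall fun s hs => ?_
    have hvs := hv.pos s hs
    have hexp : (r - 1) * (q.toReal - 1) = 1 := by
      have := hc.mul_eq_add
      rw [← hr] at this
      linarith
    have hPq : ∀ t, 0 < t → ENNReal.ofReal (v t ^ (r - 1)) ^ (q.toReal - 1) =
        ENNReal.ofReal (v t) := fun t ht => by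
      rw [ENNReal.ofReal_rpow_of_nonneg (Real.rpow_nonneg (hv.pos t ht).le _)
        hc.sub_one_pos.le, ← Real.rpow_mul (hv.pos t ht).le, hexp, Real.rpow_one]
    rw [hPq s hs]
    calc ∫⁻ t, k t s * ENNReal.ofReal (v t ^ (r - 1)) ^ (q.toReal - 1) ∂weightMeasure r v
        ≤ ∫⁻ t in Ioc 0 s, ENNReal.ofReal (W t)⁻¹ *
          (ENNReal.ofReal t * ENNReal.ofReal s⁻¹) * ENNReal.ofReal (v t) ∂weightMeasure r v := by
          rw [← lintegral_indicator measurableSet_Ioc]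
          refine lintegral_mono fun t => ?_
          by_cases ht : (t, s) ∈ {z : ℝ × ℝ | 0 < z.1 ∧ z.1 < z.2}
          · have ht' : t ∈ Ioc 0 s := ⟨ht.1, ht.2.le⟩
            simp only [k, indicator_of_mem ht, indicator_of_mem ht']
            rw [hPq t ht.1]
          · simp only [k, indicator_of_notMem ht, zero_mul, zero_le]
      _ = ∫⁻ t in Ioc 0 s, ENNReal.ofReal (t⁻¹ * v t ^ (-r)) * (ENNReal.ofReal (W t)⁻¹ *
          (ENNReal.ofReal t * ENNReal.ofReal s⁻¹) * ENNReal.ofReal (v t)) :=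
        setLIntegral_weightMeasure hv.measurable measurableSet_Ioc Ioc_subset_Ioi_self _
      _ ≤ ∫⁻ t in Ioc 0 s, ENNReal.ofReal (c₁ * c₂ * s ^ (-(1 / 2) : ℝ) * v s *
            t ^ (-(1 / 2) : ℝ)) := by
        refine setLIntegral_mono_ae' measurableSet_Ioc (ae_of_all _ fun t ht => ?_)
        have ht0 : 0 < t := ht.1
        have hvt := hv.pos t ht0
        have hWt := hWpos t ht0
        rw [← ENNReal.ofReal_mul (by positivity), ← ENNReal.ofReal_mul (by positivity),
          ← ENNReal.ofReal_mul (by positivity), ← ENNReal.ofReal_mul (by positivity)]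
        refine ENNReal.ofReal_le_ofReal ?_
        have hb1 := (hb t s ht0 ht.2).1
        rw [Real.div_rpow hs.le ht0.le] at hb1
        have e1 : v t ^ (-r) * v t ^ r = 1 := by
          rw [← Real.rpow_add hvt]
          simp
        have e2 : s⁻¹ * s ^ (1 / 2 : ℝ) = s ^ (-(1 / 2) : ℝ) := by
          rw [← Real.rpow_neg_one, ← Real.rpow_add hs]
          norm_num
        have e3 : t ^ (-(1 / 2) : ℝ) = (t ^ (1 / 2 : ℝ))⁻¹ := Real.rpow_neg ht0.le _
        calc t⁻¹ * v t ^ (-r) * ((W t)⁻¹ * (t * s⁻¹) * v t)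
            ≤ t⁻¹ * v t ^ (-r) * ((c₂ * v t ^ r) * (t * s⁻¹) *
              (c₁ * (s ^ (1 / 2 : ℝ) / t ^ (1 / 2 : ℝ)) * v s)) := by
              have := hWb t ht0
              gcongr
          _ = (t⁻¹ * t) * (v t ^ (-r) * v t ^ r) * (c₁ * c₂ * (s⁻¹ * s ^ (1 / 2 : ℝ)) * v s *
              (t ^ (1 / 2 : ℝ))⁻¹) := by ring
          _ = _ := by rw [e1, e2, e3, inv_mul_cancel₀ ht0.ne', one_mul, one_mul]
      _ = ENNReal.ofReal (2 * c₁ * c₂) * ENNReal.ofReal (v s) := by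
        have hi := intervalIntegral.intervalIntegrable_rpow' (a := 0) (b := s)
          (show (-1 : ℝ) < -(1 / 2) by norm_num)
        rw [intervalIntegrable_iff_integrableOn_Ioc_of_le hs.le] at hi
        rw [← ofReal_integral_eq_lintegral_ofReal (hi.const_mul _)
            (by
              filter_upwards [ae_restrict_mem measurableSet_Ioc] with t ht
              have ht0 : 0 < t := ht.1
              simp only [Pi.zero_apply]
              positivity),
            integral_const_mul, ← intervalIntegral.integral_of_le hs.le,
            integral_rpow (Or.inl (by norm_num)), Real.zero_rpow (by norm_num),
            ← ENNReal.ofReal_mul (by positivity)]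
        congr 1
        have e4 : s ^ (-(1 / 2) : ℝ) * s ^ (-(1 / 2) + 1 : ℝ) = 1 := by
          rw [← Real.rpow_add hs]
          norm_num
        calc _ = 2 * c₁ * c₂ * v s * (s ^ (-(1 / 2) : ℝ) * s ^ (-(1 / 2) + 1 : ℝ)) := by ring
          _ = _ := by rw [e4]; ring

end Hardy

/-! ### Sums, intersections and the functionals of a compatible couple -/

namespace CompatibleCouple

set_option linter.unusedSectionVars false

variable {X₀ X₁ E : Type*}
  [NormedAddCommGroup X₀] [NormedSpace ℝ X₀] [NormedAddCommGroup X₁] [NormedSpace ℝ X₁]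
  [AddCommGroup E] [Module ℝ E] [TopologicalSpace E] [IsTopologicalAddGroup E] [T2Space E]
  (C : CompatibleCouple X₀ X₁ E)

theorem mkSum_add (x x' : X₀) (y y' : X₁) :
    C.mkSum (x + x') (y + y') = C.mkSum x y + C.mkSum x' y' := by
  simp only [mkSum, ← map_add]
  rfl

theorem mkSum_smul (c : ℝ) (x : X₀) (y : X₁) : C.mkSum (c • x) (c • y) = c • C.mkSum x y := by
  simp only [mkSum, ← map_smul]
  rfl

theorem mkSum_eq_iff {x x' : X₀} {y y' : X₁} :
    C.mkSum x y = C.mkSum x' y' ↔ C.ι₀ x + C.ι₁ y = C.ι₀ x' + C.ι₁ y' := by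
  rw [mkSum, mkSum, Submodule.mkQ_apply, Submodule.mkQ_apply, Submodule.Quotient.eq, addKer,
    LinearMap.mem_ker, map_sub, sub_eq_zero]
  rfl

theorem mkSum_surjective (f : C.SumSpace) : ∃ x y, C.mkSum x y = f := by
  obtain ⟨z, rfl⟩ := Submodule.mkQ_surjective _ f
  exact ⟨z.fst, z.snd, rfl⟩

theorem norm_mkSum_le (x : X₀) (y : X₁) : ‖C.mkSum x y‖ ≤ ‖x‖ + ‖y‖ := by
  refine (Submodule.Quotient.norm_mk_le _ _).trans_eq ?_
  rw [WithLp.prod_norm_eq_of_L1]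
  rfl

/-- The embedding of `X₀` in `X₀ + X₁`. -/
noncomputable def inl : X₀ →L[ℝ] C.SumSpace :=
  LinearMap.mkContinuous
    { toFun := fun x => C.mkSum x 0
      map_add' := fun x x' => by rw [← mkSum_add, add_zero]
      map_smul' := fun c x => by rw [RingHom.id_apply, ← mkSum_smul, smul_zero] } 1
    fun x => by simpa using C.norm_mkSum_le x 0

/-- The embedding of `X₁` in `X₀ + X₁`. -/
noncomputable def inr : X₁ →L[ℝ] C.SumSpace :=
  LinearMap.mkContinuous
    { toFun := fun x => C.mkSum 0 x
      map_add' := fun x x' => by rw [← mkSum_add, add_zero]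
      map_smul' := fun c x => by rw [RingHom.id_apply, ← mkSum_smul, smul_zero] } 1
    fun x => by simpa using C.norm_mkSum_le 0 x

theorem inl_apply (x : X₀) : C.inl x = C.mkSum x 0 := rfl

theorem inr_apply (x : X₁) : C.inr x = C.mkSum 0 x := rfl

theorem mkSum_eq (x : X₀) (y : X₁) : C.mkSum x y = C.inl x + C.inr y := by
  rw [inl_apply, inr_apply, ← mkSum_add, add_zero, zero_add]

theorem inl_injective : Function.Injective C.inl := fun x x' h => by
  rw [inl_apply, inl_apply, mkSum_eq_iff] at h
  exact C.injective₀ (by simpa using h)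

/-- The embedding of `X₀ ∩ X₁` in `X₀`. -/
noncomputable def fst : C.InterSpace →L[ℝ] X₀ :=
  (ContinuousLinearMap.fst ℝ X₀ X₁).comp (Submodule.subtypeL _)

/-- The embedding of `X₀ ∩ X₁` in `X₁`. -/
noncomputable def snd : C.InterSpace →L[ℝ] X₁ :=
  (ContinuousLinearMap.snd ℝ X₀ X₁).comp (Submodule.subtypeL _)

theorem interToSum_eq_inl (u : C.InterSpace) : C.interToSum u = C.inl (C.fst u) := rfl

theorem interToSum_eq_inr (u : C.InterSpace) : C.interToSum u = C.inr (C.snd u) := by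
  have h : C.ι₀ u.1.1 = C.ι₁ u.1.2 := u.2
  rw [interToSum, inr_apply, mkSum_eq_iff]
  rw [map_zero, map_zero, add_zero, zero_add]
  exact h

theorem exists_inter {x : X₀} {y : X₁} (h : C.inl x = C.inr y) :
    ∃ w : C.InterSpace, C.fst w = x ∧ C.snd w = y := by
  rw [inl_apply, inr_apply, mkSum_eq_iff] at h
  exact ⟨⟨(x, y), by simpa using h⟩, rfl, rfl⟩

theorem norm_le_max (w : C.InterSpace) : ‖w‖ ≤ max ‖C.fst w‖ ‖C.snd w‖ := le_rfl

theorem norm_fst_le (w : C.InterSpace) : ‖C.fst w‖ ≤ ‖w‖ := le_max_left _ _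

theorem norm_snd_le (w : C.InterSpace) : ‖C.snd w‖ ≤ ‖w‖ := le_max_right _ _

/-! ### The functionals -/

theorem J_eq (u : C.InterSpace) (t : ℝ) : C.J u t = max ‖C.fst u‖ (t * ‖C.snd u‖) := rfl

theorem J_nonneg (u : C.InterSpace) (t : ℝ) : 0 ≤ C.J u t := (norm_nonneg _).trans (le_max_left _ _)

theorem norm_fst_le_J (u : C.InterSpace) (t : ℝ) : ‖C.fst u‖ ≤ C.J u t := le_max_left _ _

theorem norm_snd_le_J (u : C.InterSpace) {t : ℝ} (ht : 0 < t) : ‖C.snd u‖ ≤ t⁻¹ * C.J u t := by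
  have h : t * ‖C.snd u‖ ≤ C.J u t := le_max_right _ _
  rw [inv_mul_eq_div, le_div_iff₀ ht]
  linarith

theorem J_smul (c : ℝ) (u : C.InterSpace) (t : ℝ) : C.J (c • u) t = |c| * C.J u t := by
  simp only [J_eq, map_smul, norm_smul, Real.norm_eq_abs]
  rw [mul_max_of_nonneg _ _ (abs_nonneg c)]
  congr 1
  ring

theorem J_add_le (u w : C.InterSpace) {t : ℝ} (ht : 0 ≤ t) :
    C.J (u + w) t ≤ C.J u t + C.J w t := by
  simp only [J_eq, map_add]
  refine max_le ((norm_add_le _ _).trans (add_le_add (le_max_left _ _) (le_max_left _ _))) ?_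
  calc t * ‖C.snd u + C.snd w‖ ≤ t * (‖C.snd u‖ + ‖C.snd w‖) := by
        gcongr
        exact norm_add_le _ _
    _ = t * ‖C.snd u‖ + t * ‖C.snd w‖ := by ring
    _ ≤ _ := add_le_add (le_max_right _ _) (le_max_right _ _)

theorem J_zero (t : ℝ) : C.J 0 t = 0 := by simp [J_eq]

theorem J_le_norm (u : C.InterSpace) (t : ℝ) : C.J u t ≤ max 1 t * ‖u‖ := by
  rw [J_eq]
  have h0 := norm_nonneg u
  refine max_le ?_ ?_
  · calc ‖C.fst u‖ ≤ 1 * ‖u‖ := by simpa using C.norm_fst_le u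
      _ ≤ _ := by gcongr; exact le_max_left _ _
  · calc t * ‖C.snd u‖ ≤ max 1 t * ‖C.snd u‖ := by gcongr; exact le_max_right _ _
      _ ≤ _ := by gcongr; exact C.norm_snd_le u

theorem aestronglyMeasurable_J {u : ℝ → C.InterSpace} {μ : Measure ℝ}
    (hu : AEStronglyMeasurable u μ) : AEStronglyMeasurable (fun t => C.J (u t) t) μ := by
  have h1 := (C.fst.continuous.comp_aestronglyMeasurable hu).norm
  have h2 := (C.snd.continuous.comp_aestronglyMeasurable hu).norm
  exact h1.sup (aestronglyMeasurable_id.mul h2)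

theorem K_bddBelow (f : C.SumSpace) {t : ℝ} (ht : 0 ≤ t) :
    BddBelow {r : ℝ | ∃ (f₀ : X₀) (f₁ : X₁), f = C.mkSum f₀ f₁ ∧ r = ‖f₀‖ + t * ‖f₁‖} := by
  refine ⟨0, ?_⟩
  rintro r ⟨f₀, f₁, -, rfl⟩
  positivity

theorem K_nonempty (f : C.SumSpace) (t : ℝ) :
    {r : ℝ | ∃ (f₀ : X₀) (f₁ : X₁), f = C.mkSum f₀ f₁ ∧ r = ‖f₀‖ + t * ‖f₁‖}.Nonempty := by
  obtain ⟨x, y, h⟩ := C.mkSum_surjective f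
  exact ⟨_, x, y, h.symm, rfl⟩

theorem K_le {f : C.SumSpace} {f₀ : X₀} {f₁ : X₁} (h : f = C.mkSum f₀ f₁) {t : ℝ} (ht : 0 ≤ t) :
    C.K f t ≤ ‖f₀‖ + t * ‖f₁‖ := csInf_le (C.K_bddBelow f ht) ⟨f₀, f₁, h, rfl⟩

theorem le_K {f : C.SumSpace} {t b : ℝ}
    (h : ∀ f₀ f₁, f = C.mkSum f₀ f₁ → b ≤ ‖f₀‖ + t * ‖f₁‖) : b ≤ C.K f t :=
  le_csInf (C.K_nonempty f t) (by
    rintro r ⟨f₀, f₁, hf, rfl⟩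
    exact h f₀ f₁ hf)

theorem K_nonneg (f : C.SumSpace) {t : ℝ} (ht : 0 ≤ t) : 0 ≤ C.K f t :=
  C.le_K fun _ _ _ => by positivity

theorem K_monotoneOn (f : C.SumSpace) : MonotoneOn (C.K f) (Ici 0) := fun s hs t _ hst =>
  C.le_K fun f₀ f₁ hf => (C.K_le hf hs).trans (by gcongr)

theorem K_inl_le (x : X₀) {t : ℝ} (ht : 0 ≤ t) : C.K (C.inl x) t ≤ ‖x‖ := by
  simpa using C.K_le (C.inl_apply x) ht

theorem norm_le_K (f : C.SumSpace) {t : ℝ} (ht : 0 < t) : ‖f‖ ≤ max 1 t⁻¹ * C.K f t := by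
  have hm : 0 < max 1 t⁻¹ := lt_max_of_lt_left one_pos
  rw [← div_le_iff₀' hm]
  refine C.le_K fun f₀ f₁ hf => ?_
  rw [div_le_iff₀' hm, hf]
  refine (C.norm_mkSum_le _ _).trans ?_
  rw [mul_add]
  refine add_le_add ?_ ?_
  · calc ‖f₀‖ = 1 * ‖f₀‖ := (one_mul _).symm
      _ ≤ _ := by gcongr; exact le_max_left _ _
  · calc ‖f₁‖ = t⁻¹ * (t * ‖f₁‖) := by field_simp
      _ ≤ _ := by gcongr; exact le_max_right _ _

theorem exists_decomposition (f : C.SumSpace) {t : ℝ} (ht : 0 < t) :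
    ∃ f₀ f₁, f = C.mkSum f₀ f₁ ∧ ‖f₀‖ + t * ‖f₁‖ ≤ 2 * C.K f t := by
  by_cases hf : f = 0
  · refine ⟨0, 0, ?_, ?_⟩
    · rw [hf]; rfl
    · have := C.K_nonneg f ht.le
      simpa using this
  · have hK : 0 < C.K f t := by
      refine lt_of_le_of_ne (C.K_nonneg f ht.le) fun h => hf ?_
      have := C.norm_le_K f ht
      rw [← h, mul_zero] at this
      exact norm_le_zero_iff.1 this
    obtain ⟨r, ⟨f₀, f₁, h, rfl⟩, hr⟩ := exists_lt_of_csInf_lt (C.K_nonempty f t)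
      (show C.K f t < 2 * C.K f t by linarith)
    exact ⟨f₀, f₁, h, hr.le⟩

theorem norm₀_inl (x : X₀) : C.norm₀ (C.inl x) = ‖x‖ₑ := by
  refine le_antisymm (iInf₂_le_of_le (f := fun (y : X₀) (_ : C.mkSum y 0 = C.inl x) => ‖y‖ₑ) x rfl
    le_rfl) (le_iInf₂ fun y hy => ?_)
  rw [C.inl_injective hy]

theorem exists_of_norm₀_lt_top {f : C.SumSpace} (h : C.norm₀ f < ∞) : ∃ x, f = C.inl x := by
  simp only [norm₀, iInf_lt_iff] at h
  obtain ⟨x, hx, -⟩ := h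
  exact ⟨x, hx.symm⟩

/-! ### Integration -/

section Integration

variable [CompleteSpace X₀] [CompleteSpace X₁]

/-- Stated once for `X₀` and `X₁`: absolute convergence in the stronger norm of `Y` shows that the
integral in `X₀ + X₁` is the image of an element of `Y`, with a bound on its norm. -/
theorem integrableOn_interToSum_of_comp {Y : Type*} [NormedAddCommGroup Y] [NormedSpace ℝ Y]
    [CompleteSpace Y] (p : C.InterSpace →L[ℝ] Y) (i : Y →L[ℝ] C.SumSpace)
    (hi : ∀ w, C.interToSum w = i (p w)) {u : ℝ → C.InterSpace} {S : Set ℝ} (hS0 : S ⊆ Ioi 0)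
    (hS : MeasurableSet S) (hu : AEStronglyMeasurable u (volume.restrict (Ioi 0)))
    (hfin : ∫⁻ s in S, ENNReal.ofReal (s⁻¹ * ‖p (u s)‖) < ∞) :
    IntegrableOn (fun s => s⁻¹ • p (u s)) S ∧
      IntegrableOn (fun s => s⁻¹ • C.interToSum (u s)) S ∧
      ∫ s in S, s⁻¹ • C.interToSum (u s) = i (∫ s in S, s⁻¹ • p (u s)) ∧
      ‖∫ s in S, s⁻¹ • p (u s)‖ₑ ≤ ∫⁻ s in S, ENNReal.ofReal (s⁻¹ * ‖p (u s)‖) := by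
  have hm : AEStronglyMeasurable (fun s => s⁻¹ • p (u s)) (volume.restrict S) :=
    measurable_inv.aestronglyMeasurable.smul
      (p.continuous.comp_aestronglyMeasurable (hu.mono_measure (Measure.restrict_mono hS0 le_rfl)))
  have hnorm : ∫⁻ s in S, ‖s⁻¹ • p (u s)‖ₑ = ∫⁻ s in S, ENNReal.ofReal (s⁻¹ * ‖p (u s)‖) := by
    refine setLIntegral_congr_fun hS fun s hs => ?_
    have hs0 : 0 < s := hS0 hs
    rw [← ofReal_norm, norm_smul, Real.norm_of_nonneg (by positivity)]
  have hint : IntegrableOn (fun s => s⁻¹ • p (u s)) S := ⟨hm, by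
    rw [HasFiniteIntegral, hnorm]
    exact hfin⟩
  have heq : (fun s => s⁻¹ • C.interToSum (u s)) = fun s => i (s⁻¹ • p (u s)) := by
    ext s
    rw [hi, map_smul]
  refine ⟨hint, ?_, ?_, ?_⟩
  · rw [heq]
    exact i.integrable_comp hint
  · rw [heq]
    exact i.integral_comp_comm hint
  · exact (enorm_integral_le_lintegral_enorm _).trans_eq hnorm

end Integration

end CompatibleCouple

/-- On `(1,∞)` the Potter bound gives `t v(t) ≳ t^{1/2}`, so the density is `O(t^{-1-r/2})`. Hence
tails of representations converge in `X₁` without any integrability condition on `v` at infinity. -/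
theorem SlowlyVarying.weightMeasure_id_mul_Ioi_lt_top {v : ℝ → ℝ} {r : ℝ} (hv : SlowlyVarying v)
    (hr : 0 < r) : weightMeasure r (fun t => t * v t) (Ioi 1) < ∞ := by
  obtain ⟨c, hc, hb⟩ := hv.exists_bound
  have hv1 := hv.pos 1 (mem_Ioi.2 one_pos)
  have hsub : Ioi (1 : ℝ) ⊆ Ioi 0 := Ioi_subset_Ioi zero_le_one
  have hm : AEMeasurable (fun t => t * v t) (volume.restrict (Ioi 0)) :=
    measurable_id.aemeasurable.mul hv.measurable
  rw [weightMeasure_apply hm measurableSet_Ioi hsub]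
  have hint := (integrableOn_Ioi_rpow_of_lt (show -1 - r / 2 < -1 by linarith) one_pos).const_mul
    ((v 1 / c) ^ (-r))
  refine lt_of_le_of_lt ?_ hint.lintegral_lt_top
  refine setLIntegral_mono_ae' measurableSet_Ioi (ae_of_all _ fun t ht => ?_)
  have ht0 : 0 < t := hsub ht
  have hvt := hv.pos t ht0
  refine ENNReal.ofReal_le_ofReal ?_
  have h1 := (hb 1 t one_pos (le_of_lt ht)).1
  rw [div_one] at h1
  have h2 : v 1 / c * t ^ (1 / 2 : ℝ) ≤ t * v t := by
    have h3 : t ^ (1 / 2 : ℝ) * t ^ (1 / 2 : ℝ) = t := by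
      rw [← Real.rpow_add ht0]
      norm_num
    calc v 1 / c * t ^ (1 / 2 : ℝ) ≤ c * t ^ (1 / 2 : ℝ) * v t / c * t ^ (1 / 2 : ℝ) := by gcongr
      _ = (t ^ (1 / 2 : ℝ) * t ^ (1 / 2 : ℝ)) * v t := by field_simp
      _ = _ := by rw [h3]
  have h4 := Real.rpow_le_rpow_of_nonpos (by positivity) h2 (neg_nonpos.2 hr.le)
  calc t⁻¹ * (t * v t) ^ (-r) ≤ t⁻¹ * (v 1 / c * t ^ (1 / 2 : ℝ)) ^ (-r) := by gcongr
    _ = _ := by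
      rw [Real.mul_rpow (by positivity) (by positivity), ← Real.rpow_mul ht0.le, sub_eq_add_neg,
        Real.rpow_add ht0, Real.rpow_neg_one]
      ring_nf

theorem integrableOn_add {Y : Type*} [NormedAddCommGroup Y] {f g : ℝ → Y} {S : Set ℝ}
    (hf : IntegrableOn f S) (hg : IntegrableOn g S) : IntegrableOn (fun t => f t + g t) S :=
  hf.add hg

theorem integrableOn_indicator {Y : Type*} [NormedAddCommGroup Y] {f : ℝ → Y} {S T : Set ℝ}
    (hS : MeasurableSet S) (hST : S ⊆ T) (hf : IntegrableOn f S) :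
    IntegrableOn (S.indicator f) T := by
  rw [IntegrableOn, integrable_indicator_iff hS, IntegrableOn, Measure.restrict_restrict hS,
    inter_eq_self_of_subset_left hST]
  exact hf

theorem setIntegral_indicator_of_subset {Y : Type*} [NormedAddCommGroup Y] [NormedSpace ℝ Y]
    {f : ℝ → Y} {S T : Set ℝ} (hS : MeasurableSet S) (hST : S ⊆ T) :
    ∫ t in T, S.indicator f t = ∫ t in S, f t := by
  rw [integral_indicator hS, Measure.restrict_restrict hS, inter_eq_self_of_subset_left hST]

/-! ### Representations and estimates for the `J`-norm -/

namespace CompatibleCouple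

set_option linter.unusedSectionVars false

variable {X₀ X₁ E : Type*}
  [NormedAddCommGroup X₀] [NormedSpace ℝ X₀] [CompleteSpace X₀]
  [NormedAddCommGroup X₁] [NormedSpace ℝ X₁] [CompleteSpace X₁]
  [AddCommGroup E] [Module ℝ E] [TopologicalSpace E] [IsTopologicalAddGroup E] [T2Space E]
  (C : CompatibleCouple X₀ X₁ E) {q q' : ℝ≥0∞} {v : ℝ → ℝ}

/-- The weighted norm of `t ↦ J(u(t),t)` which is minimized in the definition of `jNorm`. -/
noncomputable def repNorm (q : ℝ≥0∞) (v : ℝ → ℝ) (u : ℝ → C.InterSpace) : ℝ≥0∞ :=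
  eLpNorm (fun t : ℝ => t ^ (-0 - q⁻¹.toReal) * v t * C.J (u t) t) q (volume.restrict (Ioi 0))

theorem jNorm_le_repNorm {u : ℝ → C.InterSpace} {f : C.SumSpace} (hu : C.Represents u f) :
    C.jNorm 0 q v f ≤ C.repNorm q v u :=
  iInf₂_le_of_le (f := fun u (_ : C.Represents u f) => C.repNorm q v u) u hu le_rfl

/-- Passage to the infimum over representations. The conditions on `d` let multiplication by `d`
commute with it, including the case of no representation, where the infimum is `∞`. -/
theorem le_add_mul_jNorm {f : C.SumSpace} {x y d : ℝ≥0∞} (hd0 : d ≠ 0) (hd : d ≠ ∞)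
    (h : ∀ u, C.Represents u f → x ≤ y + d * C.repNorm q v u) : x ≤ y + d * C.jNorm 0 q v f := by
  rw [← tsub_le_iff_left, mul_comm, ← ENNReal.div_le_iff hd0 hd]
  refine le_iInf₂ fun u hu => ?_
  rw [ENNReal.div_le_iff hd0 hd, mul_comm, tsub_le_iff_left]
  exact h u hu

theorem repNorm_eq (hq : 1 < q) (hqq' : q⁻¹ + q'⁻¹ = 1) (hv : SlowlyVarying v)
    (u : ℝ → C.InterSpace) : C.repNorm q v u =
      eLpNorm (fun t => v t ^ q'.toReal * C.J (u t) t) q (weightMeasure q'.toReal v) := by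
  rw [← eLpNorm_weight hq hqq' hv.pos hv.measurable]
  refine eLpNorm_congr_ae ?_
  filter_upwards [ae_restrict_mem measurableSet_Ioi] with t ht
  have hvt := hv.pos t ht
  rw [mul_assoc, mul_assoc, ← mul_assoc (v t ^ _), ← Real.rpow_add hvt]
  simp

theorem interToSum_add (u w : C.InterSpace) :
    C.interToSum (u + w) = C.interToSum u + C.interToSum w := by
  simp only [interToSum_eq_inl, map_add]

theorem interToSum_smul (c : ℝ) (u : C.InterSpace) :
    C.interToSum (c • u) = c • C.interToSum u := by
  simp only [interToSum_eq_inl, map_smul]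

theorem Represents.add {u u' : ℝ → C.InterSpace} {f f' : C.SumSpace} (hu : C.Represents u f)
    (hu' : C.Represents u' f') : C.Represents (fun t => u t + u' t) (f + f') where
  stronglyMeasurable := hu.stronglyMeasurable.add hu'.stronglyMeasurable
  integrable := by
    simp only [interToSum_add, smul_add]
    exact integrableOn_add hu.integrable hu'.integrable
  integral_eq := by
    simp only [interToSum_add, smul_add]
    rw [integral_add hu.integrable hu'.integrable, hu.integral_eq, hu'.integral_eq]

/-- The factor `t` cancels the density of `ds/s`, and `(1,2]` has length `1`. -/
theorem represents_indicator (w : C.InterSpace) :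
    C.Represents ((Ioc 1 2).indicator fun t => t • w) (C.interToSum w) := by
  have heq : EqOn (fun s : ℝ => s⁻¹ • C.interToSum ((Ioc 1 2).indicator (fun t => t • w) s))
      ((Ioc 1 2).indicator fun _ => C.interToSum w) (Ioi 0) := by
    intro s hs
    have hs0 : s ≠ 0 := ne_of_gt hs
    by_cases h : s ∈ Ioc (1 : ℝ) 2
    · simp only [indicator_of_mem h]
      rw [interToSum_smul, smul_smul, inv_mul_cancel₀ hs0, one_smul]
    · simp only [indicator_of_notMem h, interToSum_eq_inl, map_zero, smul_zero]
  have hsub : Ioc (1 : ℝ) 2 ⊆ Ioi 0 := fun x hx => one_pos.trans hx.1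
  refine ⟨?_, ?_, ?_⟩
  · exact (stronglyMeasurable_id.smul_const w).aestronglyMeasurable.indicator measurableSet_Ioc
  · rw [integrableOn_congr_fun heq measurableSet_Ioi]
    exact integrableOn_indicator measurableSet_Ioc hsub (integrableOn_const (by simp))
  · rw [setIntegral_congr_fun measurableSet_Ioi heq,
      setIntegral_indicator_of_subset measurableSet_Ioc hsub]
    simp
    norm_num

/-- Adding an element of `X₀ ∩ X₁` to a represented element. -/
theorem exists_jNorm_add_le (hq : 1 < q) (hv : SlowlyVarying v) :
    ∃ c : ℝ≥0, ∀ u g w, C.Represents u g →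
      C.jNorm 0 q v (g + C.interToSum w) ≤ C.repNorm q v u + c * ‖w‖ₑ := by
  obtain ⟨c, hc, hb⟩ := hv.exists_bound
  have hv1 := hv.pos 1 (mem_Ioi.2 one_pos)
  -- On `(1,2]`: `v(t) ≤ c 2^{1/2} v(1)` by Potter, `t^{-1/q} ≤ 1`, and `J(tw,t) ≤ 4‖w‖` since `t ≤
  -- 2`.
  set M : ℝ := c * 2 ^ (1 / 2 : ℝ) * v 1 * 4 with hM
  have hM0 : 0 ≤ M := by positivity
  refine ⟨M.toNNReal, fun u g w hu => ?_⟩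
  set u₂ : ℝ → C.InterSpace := (Ioc 1 2).indicator fun t => t • w with hu₂
  have hr₂ := C.represents_indicator w
  have hmeas : ∀ {z : ℝ → C.InterSpace}, AEStronglyMeasurable z (volume.restrict (Ioi 0)) →
      AEStronglyMeasurable (fun t : ℝ => t ^ (-0 - q⁻¹.toReal) * v t * C.J (z t) t)
        (volume.restrict (Ioi 0)) := fun hz =>
    (((measurable_id.pow_const _).aemeasurable.mul hv.measurable).aestronglyMeasurable).mul
      (C.aestronglyMeasurable_J hz)
  have h2 : C.repNorm q v u₂ ≤ M.toNNReal * ‖w‖ₑ := by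
    calc C.repNorm q v u₂ ≤ eLpNorm ((Ioc (1 : ℝ) 2).indicator fun _ => M * ‖w‖) q
          (volume.restrict (Ioi 0)) := by
          refine eLpNorm_mono_enorm_ae ?_
          filter_upwards [ae_restrict_mem measurableSet_Ioi] with t ht
          have ht0 : 0 < t := ht
          by_cases h : t ∈ Ioc (1 : ℝ) 2
          · have hvt := hv.pos t ht
            simp only [hu₂, indicator_of_mem h]
            have hJ := C.J_nonneg (t • w) t
            rw [Real.enorm_of_nonneg (by positivity), Real.enorm_of_nonneg (by positivity)]
            refine ENNReal.ofReal_le_ofReal ?_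
            have e1 : t ^ (-0 - q⁻¹.toReal) ≤ 1 :=
              Real.rpow_le_one_of_one_le_of_nonpos h.1.le (by simp)
            have e2 : v t ≤ c * 2 ^ (1 / 2 : ℝ) * v 1 := by
              refine (hb 1 t one_pos h.1.le).2.trans ?_
              rw [div_one]
              have := h.2
              gcongr
            have e3 : C.J (t • w) t ≤ 4 * ‖w‖ := by
              rw [J_smul, abs_of_pos ht0]
              have h3 : max 1 t ≤ 2 := max_le (by norm_num) h.2
              have h4 : C.J w t ≤ 2 * ‖w‖ := (C.J_le_norm w t).trans (by gcongr)
              calc t * C.J w t ≤ 2 * (2 * ‖w‖) :=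
                    mul_le_mul h.2 h4 (C.J_nonneg w t) zero_le_two
                _ = _ := by ring
            calc _ ≤ 1 * (c * 2 ^ (1 / 2 : ℝ) * v 1) * (4 * ‖w‖) := by gcongr
              _ = _ := by rw [hM]; ring
          · simp only [hu₂, indicator_of_notMem h, J_zero, mul_zero, enorm_zero, zero_le]
      _ ≤ ‖M * ‖w‖‖ₑ * (volume.restrict (Ioi 0) (Ioc 1 2)) ^ (1 / q.toReal) :=
        eLpNorm_indicator_const_le _ _
      _ ≤ ‖M * ‖w‖‖ₑ * 1 := by
        gcongr
        refine ENNReal.rpow_le_one ?_ (by positivity)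
        refine (Measure.restrict_le_self _).trans ?_
        simp
        norm_num
      _ = _ := by
        rw [mul_one, enorm_mul, enorm_norm, Real.enorm_of_nonneg hM0]
        rfl
  refine (C.jNorm_le_repNorm (hu.add C hr₂)).trans (le_trans ?_ (add_le_add_right h2 _))
  refine le_trans ?_ (eLpNorm_add_le (hmeas hu.stronglyMeasurable) (hmeas hr₂.stronglyMeasurable)
    hq.le)
  refine eLpNorm_mono_enorm_ae ?_
  filter_upwards [ae_restrict_mem measurableSet_Ioi] with t ht
  have ht0 : 0 < t := ht
  have hvt := hv.pos t ht
  have hJ1 := C.J_nonneg (u t) t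
  have hJ2 := C.J_nonneg (u₂ t) t
  have hJ3 := C.J_nonneg (u t + u₂ t) t
  rw [Pi.add_apply, Real.enorm_of_nonneg (by positivity), Real.enorm_of_nonneg (by positivity),
    ← mul_add]
  refine ENNReal.ofReal_le_ofReal ?_
  gcongr
  exact C.J_add_le _ _ ht0.le

theorem setLIntegral_fst_le (hq : 1 < q) (hqq' : q⁻¹ + q'⁻¹ = 1) (hv : SlowlyVarying v)
    {u : ℝ → C.InterSpace} (hu : AEStronglyMeasurable u (volume.restrict (Ioi 0))) {S : Set ℝ}
    (hS : MeasurableSet S) (hS0 : S ⊆ Ioi 0) :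
    ∫⁻ s in S, ENNReal.ofReal (s⁻¹ * ‖C.fst (u s)‖) ≤
      C.repNorm q v u * weightMeasure q'.toReal v S ^ (q'.toReal⁻¹) := by
  refine le_trans ?_ (setLIntegral_inv_mul_le hq hqq' hv.pos hv.measurable hS hS0
    (C.aestronglyMeasurable_J hu).aemeasurable)
  refine setLIntegral_mono_ae' hS (ae_of_all _ fun s hs => ENNReal.ofReal_le_ofReal ?_)
  have hs0 : 0 < s := hS0 hs
  gcongr
  exact C.norm_fst_le_J _ _

/-- Hölder's inequality with the weight `t v(t)` in place of `v`: the extra factor `t` is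
compensated by `‖u‖_{X₁} ≤ t⁻¹ J(u,t)`, so the same norm of `u` appears. -/
theorem setLIntegral_snd_le (hq : 1 < q) (hqq' : q⁻¹ + q'⁻¹ = 1) (hv : SlowlyVarying v)
    {u : ℝ → C.InterSpace} (hu : AEStronglyMeasurable u (volume.restrict (Ioi 0))) :
    ∫⁻ s in Ioi 1, ENNReal.ofReal (s⁻¹ * ‖C.snd (u s)‖) ≤
      C.repNorm q v u * weightMeasure q'.toReal (fun t => t * v t) (Ioi 1) ^ (q'.toReal⁻¹) := by
  have hpos : ∀ t ∈ Ioi (0 : ℝ), 0 < t * v t := fun t ht => mul_pos ht (hv.pos t ht)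
  have h := setLIntegral_inv_mul_le hq hqq' hpos (measurable_id.aemeasurable.mul hv.measurable)
    measurableSet_Ioi (Ioi_subset_Ioi zero_le_one)
    (measurable_inv.aemeasurable.mul (C.aestronglyMeasurable_J hu).aemeasurable)
  have he : eLpNorm (fun t => t ^ (-0 - q⁻¹.toReal) * (t * v t) * (t⁻¹ * C.J (u t) t)) q
      (volume.restrict (Ioi 0)) = C.repNorm q v u := by
    refine eLpNorm_congr_ae ?_
    filter_upwards [ae_restrict_mem measurableSet_Ioi] with t ht
    have ht0 : t ≠ 0 := ne_of_gt ht
    field_simp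
  rw [← he]
  refine le_trans ?_ h
  refine setLIntegral_mono_ae' measurableSet_Ioi
    (ae_of_all _ fun s hs => ENNReal.ofReal_le_ofReal ?_)
  have hs0 : (0 : ℝ) < s := one_pos.trans hs
  simp only [Pi.mul_apply]
  gcongr
  exact C.norm_snd_le_J _ hs0

/-- `(X₀,X₁)_{0,q,a;J} ⊆ X₀` if `∫_0^∞ t⁻¹ a^{-q'} < ∞`. -/
theorem exists_norm₀_le_jNorm (hq : 1 < q) (hqq' : q⁻¹ + q'⁻¹ = 1) (hv : SlowlyVarying v)
    (hfin : weightMeasure q'.toReal v (Ioi 0) < ∞) :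
    ∃ c : ℝ≥0, ∀ f, C.norm₀ f ≤ c * C.jNorm 0 q v f := by
  have hr := one_le_conj_toReal hq hqq'
  set d := weightMeasure q'.toReal v (Ioi 0) ^ (q'.toReal⁻¹) with hd
  have hd' : d ≠ ∞ := ENNReal.rpow_ne_top_of_nonneg (by positivity) hfin.ne
  -- The summand `1` ensures a nonzero constant, as `le_add_mul_jNorm` requires.
  refine ⟨1 + d.toNNReal, fun f => ?_⟩
  rw [ENNReal.coe_add, ENNReal.coe_toNNReal hd', ENNReal.coe_one]
  rw [← zero_add ((1 + d) * _)]
  refine C.le_add_mul_jNorm (by simp) (by simp [hd']) fun u hu => ?_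
  rw [zero_add]
  by_cases hN : C.repNorm q v u = ∞
  · simp [hN]
  have hle := C.setLIntegral_fst_le hq hqq' hv hu.stronglyMeasurable measurableSet_Ioi le_rfl
  obtain ⟨-, -, h3, h4⟩ := C.integrableOn_interToSum_of_comp C.fst C.inl C.interToSum_eq_inl
    le_rfl measurableSet_Ioi hu.stronglyMeasurable
    (hle.trans_lt (ENNReal.mul_lt_top (lt_top_iff_ne_top.2 hN) (lt_top_iff_ne_top.2 hd')))
  rw [hu.integral_eq] at h3
  rw [h3, norm₀_inl]
  calc _ ≤ C.repNorm q v u * d := h4.trans hle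
    _ = d * C.repNorm q v u := mul_comm _ _
    _ ≤ (1 + d) * C.repNorm q v u := by
      gcongr ?_ * _
      exact le_add_self

/-- On `X₀`, the `J`-norm depends only on the values of the weight near `0`. -/
theorem exists_jNorm_le_interNorm₀ {a : ℝ → ℝ} (hq : 1 < q) (hqq' : q⁻¹ + q'⁻¹ = 1)
    (ha : SlowlyVarying a) (hv : SlowlyVarying v) (hav : ∀ x ∈ Ioc (0 : ℝ) 1, v x = a x)
    (hfin : weightMeasure q'.toReal v (Ioc 0 1) < ∞) :
    ∃ c : ℝ≥0, ∀ f, C.jNorm 0 q a f ≤ c * C.interNorm₀ (C.jNorm 0 q v) f := by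
  have hr := one_le_conj_toReal hq hqq'
  obtain ⟨c₀, hc₀⟩ := C.exists_jNorm_add_le hq ha
  set d := weightMeasure q'.toReal v (Ioc 0 1) ^ (q'.toReal⁻¹) with hd
  have hdt : d ≠ ∞ := ENNReal.rpow_ne_top_of_nonneg (by positivity) hfin.ne
  set e := weightMeasure q'.toReal (fun t => t * v t) (Ioi 1) ^ (q'.toReal⁻¹) with he
  have het : e ≠ ∞ := ENNReal.rpow_ne_top_of_nonneg (by positivity)
    (hv.weightMeasure_id_mul_Ioi_lt_top (by linarith)).ne
  set D : ℝ≥0∞ := 1 + c₀ * (d + e) with hD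
  have hDt : D ≠ ∞ := by
    rw [hD]
    finiteness
  have hD0 : D ≠ 0 := by simp [hD]
  refine ⟨c₀ + D.toNNReal, fun f => ?_⟩
  rw [ENNReal.coe_add, ENNReal.coe_toNNReal hDt]
  by_cases hf : C.norm₀ f = ∞
  · rw [interNorm₀, hf, max_eq_left le_top, ENNReal.mul_top (by simp [hD0])]
    exact le_top
  obtain ⟨x, rfl⟩ := C.exists_of_norm₀_lt_top (lt_top_iff_ne_top.2 hf)
  suffices h : C.jNorm 0 q a (C.inl x) ≤ c₀ * ‖x‖ₑ + D * C.jNorm 0 q v (C.inl x) by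
    refine h.trans ?_
    rw [interNorm₀, norm₀_inl, add_mul (c₀ : ℝ≥0∞) D]
    exact add_le_add (mul_le_mul_right (le_max_left _ _) _) (mul_le_mul_right (le_max_right _ _) _)
  refine C.le_add_mul_jNorm hD0 hDt fun u hu => ?_
  by_cases hN : C.repNorm q v u = ∞
  · simp [hN, ENNReal.mul_top hD0]
  have hum := hu.stronglyMeasurable
  have hle₀ := C.setLIntegral_fst_le hq hqq' hv hum measurableSet_Ioc
    (show Ioc (0 : ℝ) 1 ⊆ Ioi 0 from Ioc_subset_Ioi_self)
  have hle₁ := C.setLIntegral_snd_le hq hqq' hv hum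
  obtain ⟨-, i₀, j₀, k₀⟩ := C.integrableOn_interToSum_of_comp C.fst C.inl C.interToSum_eq_inl
    Ioc_subset_Ioi_self measurableSet_Ioc hum
    (hle₀.trans_lt (ENNReal.mul_lt_top (lt_top_iff_ne_top.2 hN) (lt_top_iff_ne_top.2 hdt)))
  obtain ⟨-, i₁, j₁, k₁⟩ := C.integrableOn_interToSum_of_comp C.snd C.inr C.interToSum_eq_inr
    (Ioi_subset_Ioi zero_le_one) measurableSet_Ioi hum
    (hle₁.trans_lt (ENNReal.mul_lt_top (lt_top_iff_ne_top.2 hN) (lt_top_iff_ne_top.2 het)))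
  set x₀ := ∫ s in Ioc (0 : ℝ) 1, s⁻¹ • C.fst (u s)
  set y := ∫ s in Ioi (1 : ℝ), s⁻¹ • C.snd (u s)
  have hxy : C.inl x = C.inl x₀ + C.inr y := by
    rw [← j₀, ← j₁, ← setIntegral_union (Ioc_disjoint_Ioi le_rfl) measurableSet_Ioi i₀ i₁,
      Ioc_union_Ioi_eq_Ioi zero_le_one, hu.integral_eq]
  -- This is where membership of `x` in `X₀` enters: the tail `y`, a priori only in `X₁`, equals `x
  -- - x₀`. The part of `u` on `(0,1]`, where the weights agree, is kept, and the tail is replaced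
  -- by a representation of `w`.
  obtain ⟨w, hw₀, hw₁⟩ := C.exists_inter (x := x - x₀) (y := y) (by
    rw [map_sub, hxy]
    abel)
  have hrep : C.Represents ((Ioc 0 1).indicator u) (C.inl x₀) := by
    have hind : (fun s : ℝ => s⁻¹ • C.interToSum ((Ioc 0 1).indicator u s)) =
        (Ioc 0 1).indicator fun s => s⁻¹ • C.interToSum (u s) := by
      ext s
      by_cases h : s ∈ Ioc (0 : ℝ) 1
      · simp only [indicator_of_mem h]
      · simp only [indicator_of_notMem h, interToSum_eq_inl, map_zero, smul_zero]
    refine ⟨hum.indicator measurableSet_Ioc, ?_, ?_⟩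
    · rw [hind]
      exact integrableOn_indicator measurableSet_Ioc Ioc_subset_Ioi_self i₀
    · rw [hind, setIntegral_indicator_of_subset measurableSet_Ioc Ioc_subset_Ioi_self, j₀]
  have hf : C.inl x = C.inl x₀ + C.interToSum w := by
    rw [interToSum_eq_inl, hw₀, ← map_add]
    congr 1
    abel
  have hrn : C.repNorm q a ((Ioc 0 1).indicator u) ≤ C.repNorm q v u := by
    refine eLpNorm_mono_enorm_ae ?_
    filter_upwards [ae_restrict_mem measurableSet_Ioi] with t ht
    by_cases h : t ∈ Ioc (0 : ℝ) 1
    · simp only [indicator_of_mem h, hav t h, le_refl]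
    · simp only [indicator_of_notMem h, J_zero, mul_zero, enorm_zero, zero_le]
  have hwn : ‖w‖ₑ ≤ ‖x‖ₑ + (d + e) * C.repNorm q v u := by
    have h1 : ‖w‖ₑ ≤ ‖x - x₀‖ₑ + ‖y‖ₑ := by
      rw [← ofReal_norm, ← ofReal_norm, ← ofReal_norm,
        ← ENNReal.ofReal_add (norm_nonneg _) (norm_nonneg _)]
      refine ENNReal.ofReal_le_ofReal ((C.norm_le_max w).trans ?_)
      rw [hw₀, hw₁]
      exact max_le_add_of_nonneg (norm_nonneg _) (norm_nonneg _)
    calc ‖w‖ₑ ≤ ‖x - x₀‖ₑ + ‖y‖ₑ := h1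
      _ ≤ (‖x‖ₑ + C.repNorm q v u * d) + C.repNorm q v u * e := by
        gcongr
        · exact enorm_sub_le.trans (by gcongr; exact k₀.trans hle₀)
        · exact k₁.trans hle₁
      _ = _ := by ring
  rw [hf]
  refine (hc₀ _ _ w hrep).trans ?_
  calc _ ≤ C.repNorm q v u + c₀ * (‖x‖ₑ + (d + e) * C.repNorm q v u) := by gcongr
    _ = _ := by rw [hD]; ring

theorem kNorm_eq (hq : 1 < q) (hqq' : q⁻¹ + q'⁻¹ = 1) (hv : SlowlyVarying v) {B : ℝ → ℝ}
    (hB : ∀ x : ℝ, 0 < x →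
      B x = v x ^ (1 - q'.toReal) * (weightPrimitive q'.toReal v x)⁻¹) (f : C.SumSpace) :
    C.kNorm 0 q B f = eLpNorm (fun t => (weightPrimitive q'.toReal v t)⁻¹ * C.K f t) q
      (weightMeasure q'.toReal v) := by
  rw [← eLpNorm_weight hq hqq' hv.pos hv.measurable]
  refine eLpNorm_congr_ae ?_
  filter_upwards [ae_restrict_mem measurableSet_Ioi] with t ht
  rw [hB t ht]
  ring

/-- Cutting the representation at `t` gives an admissible decomposition of `f`, unless one of the
integrals is infinite and the bound is trivial. -/
theorem ofReal_K_le {u : ℝ → C.InterSpace} {f : C.SumSpace} (hu : C.Represents u f) {t : ℝ}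
    (ht : 0 < t) : ENNReal.ofReal (C.K f t) ≤
      (∫⁻ s in Ioc 0 t, ENNReal.ofReal (s⁻¹ * ‖C.fst (u s)‖)) +
        ENNReal.ofReal t * ∫⁻ s in Ioi t, ENNReal.ofReal (s⁻¹ * ‖C.snd (u s)‖) := by
  set I₀ := ∫⁻ s in Ioc 0 t, ENNReal.ofReal (s⁻¹ * ‖C.fst (u s)‖)
  set I₁ := ∫⁻ s in Ioi t, ENNReal.ofReal (s⁻¹ * ‖C.snd (u s)‖)
  by_cases h₀ : I₀ = ∞
  · simp [h₀]
  by_cases h₁ : I₁ = ∞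
  · have : ENNReal.ofReal t ≠ 0 := by simpa using ht
    simp [h₁, ENNReal.mul_top this]
  obtain ⟨-, i₀, j₀, k₀⟩ := C.integrableOn_interToSum_of_comp C.fst C.inl C.interToSum_eq_inl
    Ioc_subset_Ioi_self measurableSet_Ioc hu.stronglyMeasurable (lt_top_iff_ne_top.2 h₀)
  obtain ⟨-, i₁, j₁, k₁⟩ := C.integrableOn_interToSum_of_comp C.snd C.inr C.interToSum_eq_inr
    (Ioi_subset_Ioi ht.le) measurableSet_Ioi hu.stronglyMeasurable (lt_top_iff_ne_top.2 h₁)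
  have hf : f = C.mkSum (∫ s in Ioc 0 t, s⁻¹ • C.fst (u s)) (∫ s in Ioi t, s⁻¹ • C.snd (u s)) := by
    rw [mkSum_eq, ← j₀, ← j₁, ← setIntegral_union (Ioc_disjoint_Ioi le_rfl) measurableSet_Ioi i₀ i₁,
      Ioc_union_Ioi_eq_Ioi ht.le, hu.integral_eq]
  refine (ENNReal.ofReal_le_ofReal (C.K_le hf ht.le)).trans ?_
  rw [ENNReal.ofReal_add (norm_nonneg _) (by positivity), ENNReal.ofReal_mul ht.le, ofReal_norm,
    ofReal_norm]
  gcongr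

/-- The `K`-norm with the associated weight is dominated by the `J`-norm. -/
theorem exists_kNorm_le_jNorm (hq : 1 < q) (hqq' : q⁻¹ + q'⁻¹ = 1) (hv : SlowlyVarying v)
    (h1 : weightMeasure q'.toReal v (Ioc 0 1) < ∞) {B : ℝ → ℝ}
    (hB : ∀ x : ℝ, 0 < x →
      B x = v x ^ (1 - q'.toReal) * (weightPrimitive q'.toReal v x)⁻¹) :
    ∃ c : ℝ≥0, ∀ f, C.kNorm 0 q B f ≤ c * C.jNorm 0 q v f := by
  obtain ⟨c, hc⟩ := exists_eLpNorm_tail_le hq hqq' hv h1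
  have hr1 : 1 ≤ q'.toReal := one_le_conj_toReal hq hqq'
  have hfin := hv.weightMeasure_Ioc_zero_lt_top (zero_le_one.trans hr1) h1
  have hkn := C.kNorm_eq hq hqq' hv hB
  have hrn := C.repNorm_eq hq hqq' hv
  have hav := fun {g} => eLpNorm_average_le (g := g) hq hqq' hv hfin
  set r := q'.toReal with hr
  set W := weightPrimitive r v with hW
  have hWm : Measurable W := (weightPrimitive_mono hfin).measurable
  have hW0 : ∀ t, 0 ≤ W t := weightPrimitive_nonneg
  refine ⟨r.toNNReal + c.toNNReal, fun f => ?_⟩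
  rw [← zero_add (_ * C.jNorm 0 q v f)]
  refine C.le_add_mul_jNorm ?_ ENNReal.coe_ne_top fun u hu => ?_
  · have : 0 < r := by linarith
    simpa using fun h : r ≤ 0 => absurd h (not_le.2 this)
  rw [zero_add, hkn]
  -- The function fed to both Hardy inequalities; its `L_q(μ)` norm is the norm of the
  -- representation.
  set g : ℝ → ℝ≥0∞ := fun t => ENNReal.ofReal (v t ^ r * C.J (u t) t) with hg
  have hJm := (C.aestronglyMeasurable_J hu.stronglyMeasurable).aemeasurable
  have hgm : AEMeasurable g (weightMeasure r v) :=
    (((hv.measurable.pow_const r).mul hJm).ennreal_ofReal).mono_ac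
      weightMeasure_absolutelyContinuous
  have hgn : eLpNorm g q (weightMeasure r v) = C.repNorm q v u := by
    rw [hrn]
    refine eLpNorm_congr_enorm_ae (ae_weightMeasure_of_forall fun t ht => ?_)
    have hvt := hv.pos t ht
    have hJ := C.J_nonneg (u t) t
    rw [enorm_eq_self, Real.enorm_of_nonneg (by positivity)]
  have hm₁ : AEMeasurable (fun t => ENNReal.ofReal (W t)⁻¹ *
      ∫⁻ s in Ioc 0 t, g s ∂weightMeasure r v) (weightMeasure r v) := by
    refine hWm.inv.ennreal_ofReal.aemeasurable.mul (Monotone.measurable ?_).aemeasurable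
    exact fun s t hst => lintegral_mono_set (Ioc_subset_Ioc_right hst)
  have hm₂ : AEMeasurable (fun t => ENNReal.ofReal (W t)⁻¹ * (ENNReal.ofReal t *
      ∫⁻ s in Ioi t, ENNReal.ofReal s⁻¹ * g s ∂weightMeasure r v)) (weightMeasure r v) := by
    refine hWm.inv.ennreal_ofReal.aemeasurable.mul
      (measurable_id.ennreal_ofReal.mul (Antitone.measurable ?_)).aemeasurable
    exact fun s t hst => lintegral_mono_set (Ioi_subset_Ioi hst)
  have hpt : ∀ t, 0 < t → ‖(W t)⁻¹ * C.K f t‖ₑ ≤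
      ‖((fun t => ENNReal.ofReal (W t)⁻¹ * ∫⁻ s in Ioc 0 t, g s ∂weightMeasure r v) +
        fun t => ENNReal.ofReal (W t)⁻¹ * (ENNReal.ofReal t *
          ∫⁻ s in Ioi t, ENNReal.ofReal s⁻¹ * g s ∂weightMeasure r v)) t‖ₑ := by
    intro t ht
    have hWt := hW0 t
    have hK := C.K_nonneg f ht.le
    rw [enorm_eq_self, Real.enorm_of_nonneg (by positivity), ENNReal.ofReal_mul (by positivity),
      Pi.add_apply, ← mul_add]
    gcongr
    refine (C.ofReal_K_le hu ht).trans ?_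
    gcongr ?_ + _ * ?_
    · rw [← setLIntegral_inv_mul hv.pos hv.measurable measurableSet_Ioc Ioc_subset_Ioi_self]
      refine setLIntegral_mono_ae' measurableSet_Ioc
        (ae_of_all _ fun s hs => ENNReal.ofReal_le_ofReal ?_)
      have hs0 : 0 < s := hs.1
      gcongr
      exact C.norm_fst_le_J _ _
    · have hsub : Ioi t ⊆ Ioi 0 := Ioi_subset_Ioi ht.le
      calc ∫⁻ s in Ioi t, ENNReal.ofReal (s⁻¹ * ‖C.snd (u s)‖)
          ≤ ∫⁻ s in Ioi t, ENNReal.ofReal (s⁻¹ * (s⁻¹ * C.J (u s) s)) := by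
            refine setLIntegral_mono_ae' measurableSet_Ioi
              (ae_of_all _ fun s hs => ENNReal.ofReal_le_ofReal ?_)
            have hs0 : 0 < s := hsub hs
            gcongr
            exact C.norm_snd_le_J _ hs0
        _ = ∫⁻ s in Ioi t, ENNReal.ofReal (v s ^ r * (s⁻¹ * C.J (u s) s)) ∂weightMeasure r v :=
          setLIntegral_inv_mul hv.pos hv.measurable measurableSet_Ioi hsub _
        _ = _ := by
          refine setLIntegral_congr_fun measurableSet_Ioi fun s hs => ?_
          have hs0 : 0 < s := hsub hs
          simp only [hg]
          rw [← ENNReal.ofReal_mul (by positivity)]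
          congr 1
          ring
  calc eLpNorm (fun t => (W t)⁻¹ * C.K f t) q (weightMeasure r v)
      ≤ _ := eLpNorm_mono_enorm_ae (ae_weightMeasure_of_forall hpt)
    _ ≤ _ := eLpNorm_add_le hm₁.aestronglyMeasurable hm₂.aestronglyMeasurable hq.le
    _ ≤ ENNReal.ofReal r * C.repNorm q v u + ENNReal.ofReal c * C.repNorm q v u := by
      rw [← hgn]
      gcongr
      · exact hav hgm
      · exact hc g hgm
    _ = _ := by
      rw [← add_mul, ENNReal.coe_add]
      rfl

end CompatibleCouple

/-! ### Discretization by levels of the primitive -/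

/-- Comparison of the `L_q` norms of functions which are controlled by constants on the pieces of
two families of sets. -/
theorem eLpNorm_le_of_pieces {α : Type*} [MeasurableSpace α] {μ : Measure α} {q : ℝ≥0∞}
    (hq : q ≠ 0) {I D : ℕ → Set α} (hI : ∀ n, MeasurableSet (I n)) (hD : ∀ n, MeasurableSet (D n))
    (hDd : Pairwise (Function.onFun Disjoint D)) (hID : ∀ n, μ (I n) ≤ μ (D n))
    (hD0 : ∀ n, μ (D n) ≠ 0) {h h' : α → ℝ} {κ : ℕ → ℝ≥0∞} (hh : ∀ n, ∀ t ∈ I n, ‖h t‖ₑ ≤ κ n)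
    (hh0 : ∀ t ∉ ⋃ n, I n, h t = 0) (hh' : ∀ n, ∀ t ∈ D n, κ n ≤ ‖h' t‖ₑ) :
    eLpNorm h q μ ≤ eLpNorm h' q μ := by
  by_cases hqt : q = ∞
  · subst hqt
    simp only [eLpNorm_exponent_top]
    -- A set `D n` of positive measure contains a point where `h'` obeys its essential bound.
    have hκ : ∀ n, κ n ≤ eLpNormEssSup h' μ := fun n => by
      obtain ⟨t, ht, ht'⟩ := ((frequently_ae_mem_iff.2 (hD0 n)).and_eventually
        (enorm_ae_le_eLpNormEssSup h' μ)).exists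
      exact (hh' n t ht).trans ht'
    refine essSup_le_of_ae_le _ (ae_of_all _ fun t => ?_)
    by_cases ht : t ∈ ⋃ n, I n
    · obtain ⟨n, hn⟩ := mem_iUnion.1 ht
      exact (hh n t hn).trans (hκ n)
    · simp [hh0 t ht]
  · have hq0 : 0 < q.toReal := ENNReal.toReal_pos hq hqt
    rw [eLpNorm_eq_lintegral_rpow_enorm_toReal hq hqt,
      eLpNorm_eq_lintegral_rpow_enorm_toReal hq hqt]
    gcongr ?_ ^ _
    calc ∫⁻ t, ‖h t‖ₑ ^ q.toReal ∂μ = ∫⁻ t in ⋃ n, I n, ‖h t‖ₑ ^ q.toReal ∂μ := by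
          rw [← lintegral_indicator (MeasurableSet.iUnion hI)]
          refine lintegral_congr fun t => ?_
          by_cases ht : t ∈ ⋃ n, I n
          · rw [indicator_of_mem ht]
          · rw [indicator_of_notMem ht, hh0 t ht, enorm_zero, ENNReal.zero_rpow_of_pos hq0]
      -- Subadditivity suffices here; disjointness is used only for the sets `D n`.
      _ ≤ ∑' n, ∫⁻ t in I n, ‖h t‖ₑ ^ q.toReal ∂μ := lintegral_iUnion_le _ _
      _ ≤ ∑' n, ∫⁻ t in D n, ‖h' t‖ₑ ^ q.toReal ∂μ := by
        refine ENNReal.tsum_le_tsum fun n => ?_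
        calc ∫⁻ t in I n, ‖h t‖ₑ ^ q.toReal ∂μ ≤ ∫⁻ t in I n, κ n ^ q.toReal ∂μ :=
              setLIntegral_mono_ae' (hI n) (ae_of_all _ fun t ht => by
                gcongr
                exact hh n t ht)
          _ ≤ ∫⁻ t in D n, κ n ^ q.toReal ∂μ := by
            rw [setLIntegral_const, setLIntegral_const]
            exact mul_le_mul_right (hID n) _
          _ ≤ _ := setLIntegral_mono_ae' (hD n) (ae_of_all _ fun t ht => by
                gcongr
                exact hh' n t ht)
      _ = ∫⁻ t in ⋃ n, D n, ‖h' t‖ₑ ^ q.toReal ∂μ := (lintegral_iUnion hD hDd _).symm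
      _ ≤ _ := setLIntegral_le_lintegral _ _

theorem exists_piecewise {α β : Type*} [Zero β] {I : ℕ → Set α}
    (hI : Pairwise (Function.onFun Disjoint I)) (F : ℕ → α → β) :
    ∃ u : α → β, (∀ n, ∀ t ∈ I n, u t = F n t) ∧ ∀ t ∉ ⋃ n, I n, u t = 0 := by
  classical
  refine ⟨fun t => if h : ∃ n, t ∈ I n then F h.choose t else 0, fun n t ht => ?_, fun t ht => ?_⟩
  · have h : ∃ n, t ∈ I n := ⟨n, ht⟩
    have : h.choose = n := by
      by_contra hne
      exact disjoint_left.1 (hI hne) h.choose_spec ht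
    simp only [h, dite_true, this]
  · rw [mem_iUnion] at ht
    simp only [ht, dite_false]

section weight

variable {r : ℝ} {v : ℝ → ℝ}

theorem setIntegral_weight (hv0 : ∀ t ∈ Ioi (0 : ℝ), 0 < v t)
    (hv : AEMeasurable v (volume.restrict (Ioi 0))) {S : Set ℝ} (hS : MeasurableSet S)
    (hS0 : S ⊆ Ioi 0) : ∫ t in S, t⁻¹ * v t ^ (-r) = (weightMeasure r v).real S := by
  rw [integral_eq_lintegral_of_nonneg_ae, measureReal_def, weightMeasure_apply hv hS hS0]
  · filter_upwards [ae_restrict_mem hS] with t ht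
    have h0 : 0 < t := hS0 ht
    have := hv0 t h0
    simp only [Pi.zero_apply]
    positivity
  · exact ((measurable_inv.aemeasurable.mul (hv.pow_const _)).mono_measure
      (Measure.restrict_mono hS0 le_rfl)).aestronglyMeasurable

/-- The values of `W`, not the arguments, are halved. Thus `W` varies by a factor at most `2` on `(s
(n+1), s n]`, and this interval carries half the mass of `(0, s n]`. -/
theorem exists_weightPrimitive_dyadic (hv0 : ∀ t ∈ Ioi (0 : ℝ), 0 < v t)
    (hv : AEMeasurable v (volume.restrict (Ioi 0)))
    (hfin : ∀ t : ℝ, weightMeasure r v (Ioc 0 t) < ∞) :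
    ∃ s : ℕ → ℝ, Antitone s ∧ ∀ n, 0 < s n ∧ s n ≤ 1 ∧
      weightPrimitive r v (s n) = weightPrimitive r v 1 / 2 ^ n := by
  have hW := weightPrimitive_pos hv0 hv hfin one_pos
  choose s hs hsW using fun n : ℕ => exists_weightPrimitive_eq (T := 1)
    (y := weightPrimitive r v 1 / 2 ^ n) hfin zero_le_one (by positivity)
    (div_le_self hW.le (one_le_pow₀ one_le_two))
  refine ⟨s, antitone_nat_of_succ_le fun n => ?_, fun n => ⟨?_, (hs n).2, hsW n⟩⟩
  · by_contra! h
    have h1 := weightPrimitive_mono hfin h.le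
    rw [hsW, hsW, pow_succ] at h1
    have h2 : weightPrimitive r v 1 / (2 ^ n * 2) < weightPrimitive r v 1 / 2 ^ n := by
      apply div_lt_div_of_pos_left hW (by positivity)
      linarith [pow_pos (zero_lt_two' ℝ) n]
    linarith
  · by_contra! h
    have h1 := hsW n
    rw [weightPrimitive_of_nonpos h] at h1
    have : 0 < weightPrimitive r v 1 / 2 ^ n := by positivity
    linarith

theorem measureReal_dyadic (hfin : ∀ t : ℝ, weightMeasure r v (Ioc 0 t) < ∞) {s : ℕ → ℝ}
    (hsa : Antitone s) (hs : ∀ n, 0 < s n ∧ s n ≤ 1 ∧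
      weightPrimitive r v (s n) = weightPrimitive r v 1 / 2 ^ n) (n : ℕ) :
    (weightMeasure r v).real (Ioc (s (n + 1)) (s n)) = weightPrimitive r v 1 / 2 ^ (n + 1) := by
  rw [weightPrimitive_sub hfin (hs (n + 1)).1.le (hsa n.le_succ), (hs n).2.2, (hs (n + 1)).2.2,
    pow_succ]
  field_simp
  norm_num

theorem weightMeasure_dyadic (hfin : ∀ t : ℝ, weightMeasure r v (Ioc 0 t) < ∞) {s : ℕ → ℝ}
    (hsa : Antitone s) (hs : ∀ n, 0 < s n ∧ s n ≤ 1 ∧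
      weightPrimitive r v (s n) = weightPrimitive r v 1 / 2 ^ n) (n : ℕ) :
    weightMeasure r v (Ioc (s (n + 1)) (s n)) =
      ENNReal.ofReal (weightPrimitive r v 1 / 2 ^ (n + 1)) := by
  have h : weightMeasure r v (Ioc (s (n + 1)) (s n)) ≠ ∞ :=
    ((measure_mono (Ioc_subset_Ioc_left (hs (n + 1)).1.le)).trans_lt (hfin _)).ne
  rw [← measureReal_dyadic hfin hsa hs, measureReal_def, ENNReal.ofReal_toReal h]

end weight

/-! ### From the `K`-functional to a representation -/

namespace CompatibleCouple

set_option linter.unusedSectionVars false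

variable {X₀ X₁ E : Type*}
  [NormedAddCommGroup X₀] [NormedSpace ℝ X₀] [CompleteSpace X₀]
  [NormedAddCommGroup X₁] [NormedSpace ℝ X₁] [CompleteSpace X₁]
  [AddCommGroup E] [Module ℝ E] [TopologicalSpace E] [IsTopologicalAddGroup E] [T2Space E]
  (C : CompatibleCouple X₀ X₁ E) {q q' : ℝ≥0∞} {v : ℝ → ℝ}

/-- The difference of two nearly optimal decompositions of `f` at the levels `s ≤ s'`. -/
theorem exists_inter_sub {f : C.SumSpace} {x x' : X₀} {y y' : X₁} {s s' : ℝ} (hs : 0 < s)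
    (hss' : s ≤ s') (h : f = C.mkSum x y) (h' : f = C.mkSum x' y')
    (hK : ‖x‖ + s * ‖y‖ ≤ 2 * C.K f s) (hK' : ‖x'‖ + s' * ‖y'‖ ≤ 2 * C.K f s') :
    ∃ d : C.InterSpace, C.fst d = x' - x ∧ ∀ t, 0 ≤ t → t ≤ s → C.J d t ≤ 4 * C.K f s' := by
  -- Both pairs sum to `f`, so `x' - x` and `y - y'` are the same element of the ambient space.
  obtain ⟨d, hd₀, hd₁⟩ := C.exists_inter (x := x' - x) (y := y - y') (by
    rw [h, mkSum_eq, mkSum_eq] at h'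
    rw [map_sub, map_sub, sub_eq_sub_iff_add_eq_add, ← h']
    abel)
  refine ⟨d, hd₀, fun t ht hts => ?_⟩
  have hmono := C.K_monotoneOn f (mem_Ici.2 hs.le) (mem_Ici.2 (hs.le.trans hss')) hss'
  rw [J_eq, hd₀, hd₁]
  have h1 : 0 ≤ s * ‖y‖ := by positivity
  have h2 : 0 ≤ s' * ‖y'‖ := mul_nonneg (hs.le.trans hss') (norm_nonneg _)
  have h3 := norm_nonneg x
  have h4 := norm_nonneg x'
  refine max_le ((norm_sub_le _ _).trans (by linarith)) ?_
  have h5 : t * ‖y‖ ≤ s * ‖y‖ := by gcongr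
  have h6 : t * ‖y'‖ ≤ s' * ‖y'‖ := by
    have := hts.trans hss'
    gcongr
  calc t * ‖y - y'‖ ≤ t * (‖y‖ + ‖y'‖) := by
        gcongr
        exact norm_sub_le _ _
    _ = t * ‖y‖ + t * ‖y'‖ := by ring
    _ ≤ _ := by linarith

/-- By monotonicity of `K` and `W`, the integral of `W⁻¹ K` over `(s (n+1), s n]` is at least `K(f,
s (n+1))/2`. By Hölder it is at most the norm times the `1/q'` power of the mass of the interval,
which tends to `0`. -/
theorem tendsto_K_dyadic (hq : 1 < q) (hqq' : q⁻¹ + q'⁻¹ = 1) (hv : SlowlyVarying v)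
    (hfin : ∀ t : ℝ, weightMeasure q'.toReal v (Ioc 0 t) < ∞) {s : ℕ → ℝ} (hsa : Antitone s)
    (hs : ∀ n, 0 < s n ∧ s n ≤ 1 ∧
      weightPrimitive q'.toReal v (s n) = weightPrimitive q'.toReal v 1 / 2 ^ n) {f : C.SumSpace}
    (hf : eLpNorm (fun t => (weightPrimitive q'.toReal v t)⁻¹ * C.K f t) q
      (weightMeasure q'.toReal v) ≠ ∞) :
    Filter.Tendsto (fun n => C.K f (s n)) Filter.atTop (nhds 0) := by
  have hr1 : 1 ≤ q'.toReal := one_le_conj_toReal hq hqq'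
  have hhol := fun {h : ℝ → ℝ} {S} => setLIntegral_enorm_le (μ := weightMeasure q'.toReal v)
    (h := h) (S := S) hq hqq'
  set r := q'.toReal with hr
  set W := weightPrimitive r v with hW
  set N := eLpNorm (fun t => (W t)⁻¹ * C.K f t) q (weightMeasure r v) with hN
  have hWm : Measurable W := (weightPrimitive_mono hfin).measurable
  have hWpos : ∀ t, 0 < t → 0 < W t := fun t ht =>
    weightPrimitive_pos hv.pos hv.measurable hfin ht
  have hW1 := hWpos 1 one_pos
  have hKm : AEStronglyMeasurable (fun t => (W t)⁻¹ * C.K f t) (weightMeasure r v) :=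
    (hWm.inv.aemeasurable.mul ((aemeasurable_restrict_of_monotoneOn measurableSet_Ioi
      ((C.K_monotoneOn f).mono Ioi_subset_Ici_self)).mono_ac
        weightMeasure_absolutelyContinuous)).aestronglyMeasurable
  have hμ : ∀ n, weightMeasure r v (Ioc (s (n + 1)) (s n)) = ENNReal.ofReal (W 1 / 2 ^ (n + 1)) :=
    weightMeasure_dyadic hfin hsa hs
  have hbound : ∀ n, ENNReal.ofReal (C.K f (s (n + 1))) ≤
      2 * (N * ENNReal.ofReal (W 1 / 2 ^ (n + 1)) ^ r⁻¹) := by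
    intro n
    have hk := C.K_nonneg f (hs (n + 1)).1.le
    have h1 : ENNReal.ofReal (C.K f (s (n + 1)) / 2) ≤
        N * ENNReal.ofReal (W 1 / 2 ^ (n + 1)) ^ r⁻¹ := by
      calc ENNReal.ofReal (C.K f (s (n + 1)) / 2)
          = ∫⁻ t in Ioc (s (n + 1)) (s n), ENNReal.ofReal ((W (s n))⁻¹ * C.K f (s (n + 1)))
            ∂weightMeasure r v := by
            rw [setLIntegral_const, hμ, ← ENNReal.ofReal_mul
              (mul_nonneg (inv_nonneg.2 (hWpos _ (hs n).1).le) hk)]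
            congr 1
            rw [(hs n).2.2, pow_succ]
            field_simp
        _ ≤ ∫⁻ t in Ioc (s (n + 1)) (s n), ‖(W t)⁻¹ * C.K f t‖ₑ ∂weightMeasure r v := by
          refine setLIntegral_mono_ae' measurableSet_Ioc (ae_of_all _ fun t ht => ?_)
          have ht0 : 0 < t := (hs (n + 1)).1.trans ht.1
          have hWt := hWpos t ht0
          have hKt := C.K_nonneg f ht0.le
          rw [Real.enorm_of_nonneg (by positivity)]
          refine ENNReal.ofReal_le_ofReal ?_
          have h2 := weightPrimitive_mono hfin ht.2
          have h3 := C.K_monotoneOn f (mem_Ici.2 (hs (n + 1)).1.le) (mem_Ici.2 ht0.le) ht.1.le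
          have h4 : (W (s n))⁻¹ ≤ (W t)⁻¹ := inv_anti₀ hWt h2
          gcongr
        _ ≤ eLpNorm (fun t => (W t)⁻¹ * C.K f t) q
            ((weightMeasure r v).restrict (Ioc (s (n + 1)) (s n))) *
            weightMeasure r v (Ioc (s (n + 1)) (s n)) ^ r⁻¹ := hhol hKm.restrict
        _ ≤ _ := by
          rw [hμ]
          gcongr
          exact eLpNorm_mono_measure _ Measure.restrict_le_self
    calc ENNReal.ofReal (C.K f (s (n + 1))) = 2 * ENNReal.ofReal (C.K f (s (n + 1)) / 2) := by
          rw [← ENNReal.ofReal_ofNat 2, ← ENNReal.ofReal_mul zero_le_two]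
          congr 1
          ring
      _ ≤ _ := by gcongr
  have hlim : Filter.Tendsto (fun n : ℕ => 2 * (N * ENNReal.ofReal (W 1 / 2 ^ (n + 1)) ^ r⁻¹))
      Filter.atTop (nhds 0) := by
    have h1 : Filter.Tendsto (fun n : ℕ => W 1 / 2 ^ (n + 1)) Filter.atTop (nhds 0) :=
      ((tendsto_pow_atTop_atTop_of_one_lt one_lt_two).comp
        (Filter.tendsto_add_atTop_nat 1)).const_div_atTop (W 1)
    have h2 := ENNReal.tendsto_ofReal h1
    rw [ENNReal.ofReal_zero] at h2
    have h3 := ((ENNReal.continuous_rpow_const (y := r⁻¹)).tendsto 0).comp h2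
    rw [ENNReal.zero_rpow_of_pos (by positivity)] at h3
    have h4 := ENNReal.Tendsto.const_mul (a := 2) (ENNReal.Tendsto.const_mul (a := N) h3
      (Or.inr hf)) (Or.inr ENNReal.ofNat_ne_top)
    simpa using h4
  have hE := tendsto_of_tendsto_of_tendsto_of_le_of_le tendsto_const_nhds hlim
    (fun _ => zero_le) hbound
  rw [← Filter.tendsto_add_atTop_iff_nat 1]
  have h5 := (ENNReal.tendsto_toReal ENNReal.zero_ne_top).comp hE
  refine h5.congr fun n => ?_
  exact ENNReal.toReal_ofReal (C.K_nonneg f (hs (n + 1)).1.le)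

/-- A form of the fundamental lemma of interpolation that works only below level `s 1`: it
represents the `X₀`-part of a nearly optimal decomposition and leaves the `X₁`-part over. -/
theorem exists_represents_of_K (hq : 1 < q) (hqq' : q⁻¹ + q'⁻¹ = 1) (hv : SlowlyVarying v)
    (hfin : ∀ t : ℝ, weightMeasure q'.toReal v (Ioc 0 t) < ∞) {s : ℕ → ℝ} (hsa : Antitone s)
    (hs : ∀ n, 0 < s n ∧ s n ≤ 1 ∧
      weightPrimitive q'.toReal v (s n) = weightPrimitive q'.toReal v 1 / 2 ^ n) {f : C.SumSpace}
    (hf : eLpNorm (fun t => (weightPrimitive q'.toReal v t)⁻¹ * C.K f t) q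
      (weightMeasure q'.toReal v) ≠ ∞) :
    ∃ u x y, C.Represents u (C.inl x) ∧ f = C.mkSum x y ∧
      ‖x‖ + s 1 * ‖y‖ ≤ 2 * C.K f (s 1) ∧
      C.repNorm q v u ≤ 32 * eLpNorm (fun t => (weightPrimitive q'.toReal v t)⁻¹ * C.K f t) q
        (weightMeasure q'.toReal v) := by
  have hr1 : 1 ≤ q'.toReal := one_le_conj_toReal hq hqq'
  have hlim := C.tendsto_K_dyadic hq hqq' hv hfin hsa hs hf
  have hrn := C.repNorm_eq hq hqq' hv
  have hfst := fun {u} {S} => C.setLIntegral_fst_le (u := u) (S := S) hq hqq' hv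
  set r := q'.toReal with hr
  set W := weightPrimitive r v with hW
  set N := eLpNorm (fun t => (W t)⁻¹ * C.K f t) q (weightMeasure r v) with hN
  have hWpos : ∀ t, 0 < t → 0 < W t := fun t ht =>
    weightPrimitive_pos hv.pos hv.measurable hfin ht
  have hW1 := hWpos 1 one_pos
  have hs0 : ∀ n, 0 < s n := fun n => (hs n).1
  have hk0 : ∀ n, 0 ≤ C.K f (s n) := fun n => C.K_nonneg f (hs0 n).le
  have hμr : ∀ n, (weightMeasure r v).real (Ioc (s (n + 1)) (s n)) = W 1 / 2 ^ (n + 1) :=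
    measureReal_dyadic hfin hsa hs
  have hμ : ∀ n, weightMeasure r v (Ioc (s (n + 1)) (s n)) = ENNReal.ofReal (W 1 / 2 ^ (n + 1)) :=
    weightMeasure_dyadic hfin hsa hs
  choose F₀ F₁ hF hFK using fun n => C.exists_decomposition f (hs0 n)
  choose d hd hdJ using fun n : ℕ => C.exists_inter_sub (hs0 (n + 2)) (hsa (n + 1).le_succ)
    (hF (n + 2)) (hF (n + 1)) (hFK (n + 2)) (hFK (n + 1))
  have hdisj : Pairwise (Function.onFun Disjoint fun n => Ioc (s (n + 1)) (s n)) :=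
    hsa.pairwise_disjoint_on_Ioc_succ
  -- The difference `d n` comes from levels `s (n+2)` and `s (n+1)`. Its interval lies below both,
  -- where `exists_inter_sub` bounds `J(d n, t)` by `4 K(f, s (n+1))`.
  let I : ℕ → Set ℝ := fun n => Ioc (s (n + 2 + 1)) (s (n + 2))
  have hIm : ∀ n, MeasurableSet (I n) := fun n => measurableSet_Ioc
  have hI0 : ∀ n, I n ⊆ Ioi 0 := fun n t ht => (hs0 _).trans ht.1
  have hId : Pairwise (Function.onFun Disjoint I) := fun m n hmn =>
    hdisj (i := m + 2) (j := n + 2) (by simpa using hmn)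
  have hUm : MeasurableSet (⋃ n, I n) := MeasurableSet.iUnion hIm
  have hU0 : (⋃ n, I n) ⊆ Ioi 0 := iUnion_subset hI0
  have hU1 : (⋃ n, I n) ⊆ Ioc 0 1 := iUnion_subset fun n t ht =>
    ⟨hI0 n ht, ht.2.trans (hs _).2.1⟩
  -- The mass of `I n` is `W(1)/2^{n+3}`, so this normalization makes `∫ u dt/t` over `I n` equal to
  -- `d n`. The factor `v^{-r}` makes `v^r J(u,t)` equal to a constant times `J(d n, t)`.
  obtain ⟨u, hu, hu0⟩ := exists_piecewise hId
    (fun n t => v t ^ (-r) • (2 ^ (n + 3) / W 1) • d n)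
  have hum : AEStronglyMeasurable u (volume.restrict (Ioi 0)) := by
    have h1 : AEStronglyMeasurable u (volume.restrict (⋃ n, I n)) := by
      rw [aestronglyMeasurable_iUnion_iff]
      intro n
      have h2 : AEStronglyMeasurable (fun t => v t ^ (-r)) (volume.restrict (I n)) :=
        ((hv.measurable.pow_const (-r)).mono_measure
          (Measure.restrict_mono (hI0 n) le_rfl)).aestronglyMeasurable
      refine (h2.smul_const ((2 ^ (n + 3) / W 1) • d n)).congr ?_
      filter_upwards [ae_restrict_mem (hIm n)] with t ht
      rw [hu n t ht]
    have h2 : (⋃ n, I n).indicator u = u := indicator_eq_self.2 fun t ht => by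
      by_contra h
      exact ht (hu0 t h)
    rw [← h2, aestronglyMeasurable_indicator_iff hUm, Measure.restrict_restrict hUm,
      inter_eq_self_of_subset_left hU0]
    exact h1
  have hrep : C.repNorm q v u ≤ 32 * N := by
    rw [hrn]
    calc eLpNorm (fun t => v t ^ r * C.J (u t) t) q (weightMeasure r v)
        -- On `I n` the left function is at most `2^{n+3}/W(1) · 4K(f, s (n+1))`, and `8 · 4 = 32`.
        -- It is compared with the right one on `(s (n+1), s n]`, which has larger mass and where
        -- `W⁻¹ K ≥ 2ⁿ/W(1) · K(f, s (n+1))`.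
        ≤ eLpNorm ((32 : ℝ) • fun t => (W t)⁻¹ * C.K f t) q (weightMeasure r v) := by
          refine eLpNorm_le_of_pieces (by positivity) hIm (fun n => measurableSet_Ioc) hdisj
            (fun n => ?_) (fun n => ?_)
            (κ := fun n => ENNReal.ofReal (32 * (2 ^ n / W 1 * C.K f (s (n + 1)))))
            (fun n t ht => ?_) (fun t ht => ?_) (fun n t ht => ?_)
          · simp only [I]
            rw [hμ, hμ]
            refine ENNReal.ofReal_le_ofReal ?_
            gcongr
            · exact one_le_two
            · omega
          · rw [hμ]
            have : 0 < W 1 / 2 ^ (n + 1) := by positivity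
            simpa using this
          · have ht0 : 0 < t := hI0 n ht
            have hvt := hv.pos t ht0
            have hvr := Real.rpow_pos_of_pos hvt r
            rw [hu n t ht, J_smul, J_smul, abs_of_pos (by positivity), abs_of_pos (by positivity),
              Real.rpow_neg hvt.le, ← mul_assoc, mul_inv_cancel₀ hvr.ne', one_mul,
              Real.enorm_of_nonneg (mul_nonneg (by positivity) (C.J_nonneg _ _))]
            refine ENNReal.ofReal_le_ofReal ?_
            calc 2 ^ (n + 3) / W 1 * C.J (d n) t
                ≤ 2 ^ (n + 3) / W 1 * (4 * C.K f (s (n + 1))) := by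
                  gcongr
                  exact hdJ n t ht0.le ht.2
              _ = _ := by ring
          · rw [hu0 t ht, J_zero, mul_zero]
          · have ht0 : 0 < t := (hs0 (n + 1)).trans ht.1
            have hWt := hWpos t ht0
            have hKt := C.K_nonneg f ht0.le
            have hk := hk0 (n + 1)
            rw [Pi.smul_apply, smul_eq_mul, Real.enorm_of_nonneg (by positivity)]
            refine ENNReal.ofReal_le_ofReal ?_
            have h2 := weightPrimitive_mono hfin ht.2
            have h3 := C.K_monotoneOn f (mem_Ici.2 (hs0 (n + 1)).le) (mem_Ici.2 ht0.le) ht.1.le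
            have h4 : (W (s n))⁻¹ ≤ (W t)⁻¹ := inv_anti₀ hWt h2
            rw [(hs n).2.2, inv_div] at h4
            gcongr
      _ = 32 * N := by
        rw [eLpNorm_const_smul, Real.enorm_of_nonneg (by norm_num)]
        norm_num [hN]
  have hfinU : weightMeasure r v (⋃ n, I n) < ∞ := (measure_mono hU1).trans_lt (hfin 1)
  obtain ⟨i, j, k, -⟩ := C.integrableOn_interToSum_of_comp C.fst C.inl C.interToSum_eq_inl hU0 hUm
    hum ((hfst hum hUm hU0).trans_lt (ENNReal.mul_lt_top
      (hrep.trans_lt (ENNReal.mul_lt_top (by simp) (lt_top_iff_ne_top.2 hf)))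
      (ENNReal.rpow_lt_top_of_nonneg (by positivity) hfinU.ne)))
  have hsum := hasSum_integral_iUnion hIm hId i
  have hterm : ∀ n, ∫ t in I n, t⁻¹ • C.fst (u t) = F₀ (n + 1) - F₀ (n + 2) := by
    intro n
    calc ∫ t in I n, t⁻¹ • C.fst (u t)
        = ∫ t in I n, (t⁻¹ * v t ^ (-r)) • (2 ^ (n + 3) / W 1) • C.fst (d n) := by
          refine setIntegral_congr_fun (hIm n) fun t ht => ?_
          simp only [hu n t ht, map_smul, smul_smul]
          ring_nf
      _ = (W 1 / 2 ^ (n + 2 + 1)) • (2 ^ (n + 3) / W 1) • C.fst (d n) := by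
        rw [integral_smul_const, setIntegral_weight hv.pos hv.measurable (hIm n) (hI0 n), hμr]
      _ = _ := by
        rw [smul_smul, hd]
        have : W 1 / 2 ^ (n + 2 + 1) * (2 ^ (n + 3) / W 1) = 1 := by field_simp
        rw [this, one_smul]
  simp only [hterm] at hsum
  -- Since `‖F₀ n‖ ≤ 2K(f, s n) → 0`, the telescoping series sums to `F₀ 1`.
  have hF0 : Filter.Tendsto F₀ Filter.atTop (nhds 0) := by
    refine squeeze_zero_norm (a := fun n => 2 * C.K f (s n)) (fun n => ?_) (by
      simpa using hlim.const_mul 2)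
    have h1 : 0 ≤ s n * ‖F₁ n‖ := mul_nonneg (hs0 n).le (norm_nonneg _)
    linarith [hFK n]
  have htel : Filter.Tendsto (fun n => ∑ i ∈ Finset.range n, (F₀ (i + 1) - F₀ (i + 2)))
      Filter.atTop (nhds (F₀ 1)) := by
    have h1 : ∀ n, ∑ i ∈ Finset.range n, (F₀ (i + 1) - F₀ (i + 2)) = F₀ 1 - F₀ (n + 1) :=
      fun n => Finset.sum_range_sub' (fun i => F₀ (i + 1)) n
    simp only [h1]
    simpa using ((Filter.tendsto_add_atTop_iff_nat 1).2 hF0).const_sub (F₀ 1)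
  have hint : ∫ t in ⋃ n, I n, t⁻¹ • C.fst (u t) = F₀ 1 :=
    tendsto_nhds_unique hsum.tendsto_sum_nat htel
  have hind : (fun t => t⁻¹ • C.interToSum (u t)) =
      (⋃ n, I n).indicator fun t => t⁻¹ • C.interToSum (u t) := by
    symm
    refine indicator_eq_self.2 fun t ht => ?_
    by_contra h
    refine ht ?_
    simp only [hu0 t h, interToSum_eq_inl, map_zero, smul_zero]
  refine ⟨u, F₀ 1, F₁ 1, ⟨hum, ?_, ?_⟩, hF 1, hFK 1, hrep⟩
  · rw [hind]
    exact integrableOn_indicator hUm hU0 j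
  · rw [hind, setIntegral_indicator_of_subset hUm hU0, k, hint]

/-- On `X₀`, the `J`-norm is dominated by the `K`-norm with the associated weight. -/
theorem exists_jNorm_le_interNorm₀_kNorm (hq : 1 < q) (hqq' : q⁻¹ + q'⁻¹ = 1)
    (hv : SlowlyVarying v) (h1 : weightMeasure q'.toReal v (Ioc 0 1) < ∞) {B : ℝ → ℝ}
    (hB : ∀ x : ℝ, 0 < x →
      B x = v x ^ (1 - q'.toReal) * (weightPrimitive q'.toReal v x)⁻¹) :
    ∃ c : ℝ≥0, ∀ f, C.jNorm 0 q v f ≤ c * C.interNorm₀ (C.kNorm 0 q B) f := by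
  have hr1 : 1 ≤ q'.toReal := one_le_conj_toReal hq hqq'
  have hfin := hv.weightMeasure_Ioc_zero_lt_top (zero_le_one.trans hr1) h1
  obtain ⟨s, hsa, hs⟩ := exists_weightPrimitive_dyadic hv.pos hv.measurable hfin
  obtain ⟨c₀, hc₀⟩ := C.exists_jNorm_add_le hq hv
  have hs1 := (hs 1).1
  -- From `K(x, s 1) ≤ ‖x‖`: `‖x₀‖ ≤ 2‖x‖` and `‖y‖ ≤ (2 / s 1)‖x‖`, while `‖w‖ ≤ ‖x‖ + ‖x₀‖ + ‖y‖`.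
  set D : ℝ := 3 + 2 / s 1 with hD
  have hD0 : 0 ≤ D := by positivity
  refine ⟨32 + c₀ * D.toNNReal, fun f => ?_⟩
  by_cases hf : C.interNorm₀ (C.kNorm 0 q B) f = ∞
  · rw [hf, ENNReal.mul_top (by simp)]
    exact le_top
  rw [interNorm₀, ← ne_eq, ← lt_top_iff_ne_top, max_lt_iff] at hf
  obtain ⟨x, rfl⟩ := C.exists_of_norm₀_lt_top hf.1
  have hN := hf.2
  rw [C.kNorm_eq hq hqq' hv hB] at hN
  obtain ⟨u, x₀, y, hu, hxy, hle, hrep⟩ :=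
    C.exists_represents_of_K hq hqq' hv hfin hsa hs hN.ne
  rw [← C.kNorm_eq hq hqq' hv hB] at hrep
  rw [mkSum_eq] at hxy
  obtain ⟨w, hw₀, hw₁⟩ := C.exists_inter (x := x - x₀) (y := y) (by
    rw [map_sub, hxy]
    abel)
  have hfw : C.inl x = C.inl x₀ + C.interToSum w := by
    rw [interToSum_eq_inl, hw₀, ← map_add]
    congr 1
    abel
  have hw : ‖w‖ ≤ D * ‖x‖ := by
    have hK := C.K_inl_le x hs1.le
    have h2 : 0 ≤ s 1 * ‖y‖ := by positivity
    have h3 := norm_nonneg x₀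
    have h4 : ‖y‖ ≤ 2 / s 1 * ‖x‖ := by
      rw [div_mul_eq_mul_div, le_div_iff₀ hs1]
      linarith
    refine (C.norm_le_max w).trans ?_
    rw [hw₀, hw₁]
    refine (max_le_add_of_nonneg (norm_nonneg _) (norm_nonneg _)).trans ?_
    have h5 := norm_sub_le x x₀
    rw [hD, add_mul]
    linarith
  have hwe : ‖w‖ₑ ≤ D.toNNReal * ‖x‖ₑ := by
    rw [← ofReal_norm, ← ofReal_norm]
    refine (ENNReal.ofReal_le_ofReal hw).trans_eq ?_
    rw [ENNReal.ofReal_mul hD0]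
    rfl
  calc C.jNorm 0 q v (C.inl x) ≤ C.repNorm q v u + c₀ * ‖w‖ₑ := by
        conv_lhs => rw [hfw]
        exact hc₀ _ _ _ hu
    _ ≤ 32 * C.kNorm 0 q B (C.inl x) + c₀ * (D.toNNReal * C.norm₀ (C.inl x)) := by
      rw [norm₀_inl]
      gcongr
    _ ≤ 32 * C.interNorm₀ (C.kNorm 0 q B) (C.inl x) +
        c₀ * (D.toNNReal * C.interNorm₀ (C.kNorm 0 q B) (C.inl x)) := by
      gcongr
      · exact le_max_right _ _
      · exact le_max_left _ _
    _ = _ := by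
      rw [ENNReal.coe_add, ENNReal.coe_mul, add_mul, mul_assoc]
      rfl

end CompatibleCouple

/-! ### Assembly of the norm inequalities -/

theorem coincide_of_le {V : Type*} {N M : V → ℝ≥0∞} {c d : ℝ≥0} (h : ∀ f, N f ≤ c * M f)
    (h' : ∀ f, M f ≤ d * N f) : Coincide N M := by
  refine ⟨?_, max c d, fun f _ => ⟨(h f).trans ?_, (h' f).trans ?_⟩⟩
  · ext f
    exact ⟨fun hf => (h' f).trans_lt (ENNReal.mul_lt_top ENNReal.coe_lt_top hf),
      fun hf => (h f).trans_lt (ENNReal.mul_lt_top ENNReal.coe_lt_top hf)⟩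
  · gcongr
    exact le_max_left _ _
  · gcongr
    exact le_max_right _ _

theorem CompatibleCouple.interNorm₀_le {X₀ X₁ E : Type*}
    [NormedAddCommGroup X₀] [NormedSpace ℝ X₀] [NormedAddCommGroup X₁] [NormedSpace ℝ X₁]
    [AddCommGroup E] [Module ℝ E] [TopologicalSpace E] [IsTopologicalAddGroup E]
    (C : CompatibleCouple X₀ X₁ E) {N : C.SumSpace → ℝ≥0∞} {b : C.SumSpace → ℝ≥0∞} {c d : ℝ≥0}
    (h : ∀ f, C.norm₀ f ≤ c * b f) (h' : ∀ f, N f ≤ d * b f) (f : C.SumSpace) :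
    C.interNorm₀ N f ≤ (max c d : ℝ≥0) * b f := by
  refine max_le ((h f).trans ?_) ((h' f).trans ?_)
  · gcongr
    exact le_max_left _ _
  · gcongr
    exact le_max_right _ _

theorem corollary1p14 {X₀ X₁ E : Type*}
    [NormedAddCommGroup X₀] [NormedSpace ℝ X₀] [CompleteSpace X₀]
    [NormedAddCommGroup X₁] [NormedSpace ℝ X₁] [CompleteSpace X₁]
    [AddCommGroup E] [Module ℝ E] [TopologicalSpace E]
    [IsTopologicalAddGroup E] [ContinuousSMul ℝ E] [T2Space E]
    (C : CompatibleCouple X₀ X₁ E)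
    (q q' : ℝ≥0∞) (hq : 1 < q) (hqq' : q⁻¹ + q'⁻¹ = 1)
    (a α A B : ℝ → ℝ)
    (ha : SlowlyVarying a)
    (ha_int : ∫⁻ t in Ioi (0 : ℝ), ENNReal.ofReal (t⁻¹ * a t ^ (-q'.toReal)) < ∞)
    (hα : SlowlyVarying α)
    (hα_zero : ∀ x : ℝ, 0 < x →
      ∫⁻ t in Ioo (0 : ℝ) x, ENNReal.ofReal (t⁻¹ * α t ^ (-q'.toReal)) < ∞)
    (hα_top : ∫⁻ t in Ioi (0 : ℝ), ENNReal.ofReal (t⁻¹ * α t ^ (-q'.toReal)) = ∞)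
    (hA : SlowlyVarying A)
    (hA_le : ∀ x ∈ Ioc (0 : ℝ) 1, A x = a x)
    (hA_gt : EquivOn (Ioi 1) A α)
    (hB : ∀ x : ℝ, 0 < x →
      B x = A x ^ (-(q' / q).toReal) * (∫ t in Ioo (0 : ℝ) x, t⁻¹ * A t ^ (-q'.toReal))⁻¹) :
    Coincide (C.jNorm 0 q a) (C.interNorm₀ (C.jNorm 0 q A)) ∧
      Coincide (C.interNorm₀ (C.jNorm 0 q A)) (C.interNorm₀ (C.kNorm 0 q B)) := by
  have hA_one : weightMeasure q'.toReal A (Ioc 0 1) < ∞ := by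
    rw [weightMeasure_apply hA.measurable measurableSet_Ioc Ioc_subset_Ioi_self]
    refine lt_of_le_of_lt ?_ ha_int
    calc ∫⁻ t in Ioc (0 : ℝ) 1, ENNReal.ofReal (t⁻¹ * A t ^ (-q'.toReal))
        = ∫⁻ t in Ioc (0 : ℝ) 1, ENNReal.ofReal (t⁻¹ * a t ^ (-q'.toReal)) :=
          setLIntegral_congr_fun measurableSet_Ioc fun t ht => by simp only [hA_le t ht]
      _ ≤ _ := lintegral_mono_set Ioc_subset_Ioi_self
  have ha_top : weightMeasure q'.toReal a (Ioi 0) < ∞ := by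
    rwa [weightMeasure_apply ha.measurable measurableSet_Ioi le_rfl]
  have ha_one : weightMeasure q'.toReal a (Ioc 0 1) < ∞ :=
    (measure_mono Ioc_subset_Ioi_self).trans_lt ha_top
  have hB' : ∀ x : ℝ, 0 < x →
      B x = A x ^ (1 - q'.toReal) * (weightPrimitive q'.toReal A x)⁻¹ := fun x hx => by
    rw [hB x hx, conj_div_toReal hq hqq', neg_sub, ← integral_Ioc_eq_integral_Ioo,
      setIntegral_weight hA.pos hA.measurable measurableSet_Ioc Ioc_subset_Ioi_self]
    rfl
  have hnorm₀ : ∀ (N : C.SumSpace → ℝ≥0∞) (f : C.SumSpace),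
      C.norm₀ f ≤ (1 : ℝ≥0) * C.interNorm₀ N f := fun N f => by
    rw [ENNReal.coe_one, one_mul]
    exact le_max_left _ _
  obtain ⟨c₁, h₁⟩ := C.exists_norm₀_le_jNorm hq hqq' ha ha_top
  obtain ⟨c₂, h₂⟩ := C.exists_jNorm_le_interNorm₀ hq hqq' ha hA hA_le hA_one
  -- The comparison of weights agreeing on `(0,1]` is symmetric; here `a` and `A` exchange roles.
  obtain ⟨c₃, h₃⟩ := C.exists_jNorm_le_interNorm₀ hq hqq' hA ha (fun x hx => (hA_le x hx).symm)
    ha_one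
  obtain ⟨c₄, h₄⟩ := C.exists_kNorm_le_jNorm hq hqq' hA hA_one hB'
  obtain ⟨c₅, h₅⟩ := C.exists_jNorm_le_interNorm₀_kNorm hq hqq' hA hA_one hB'
  have h₆ : ∀ f, C.interNorm₀ (C.jNorm 0 q a) f ≤ (max c₁ 1 : ℝ≥0) * C.jNorm 0 q a f :=
    C.interNorm₀_le h₁ fun f => by rw [ENNReal.coe_one, one_mul]
  refine ⟨coincide_of_le h₂ (C.interNorm₀_le h₁ (d := c₃ * max c₁ 1) fun f => ?_),
    coincide_of_le (C.interNorm₀_le (hnorm₀ _) h₅)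
      (C.interNorm₀_le (hnorm₀ _) (d := c₄) fun f => (h₄ f).trans ?_)⟩
  · refine (h₃ f).trans ?_
    rw [ENNReal.coe_mul, mul_assoc]
    gcongr
    exact h₆ f
  · gcongr
    exact le_max_right _ _
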